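/- **Theorem 3.11** (Alternative formulation of the original wavelet $s$-Wasserstein distance, $0<s<1$). Let $(\phi,\{\psi_\epsilon\}_{\epsilon\in\alpha})$, $\alpha$ finite, be a compactly supported, $r$-regular orthonormal wavelet system on $\mathbb{R}^n$ with $r\ge 1$, with values in $\mathbb{K}=\mathbb{R}$ or $\mathbb{K}=\mathbb{C}$. This means the following. There is an increasing sequence of closed subspaces $(V_j)_{j\in\mathbb{Z}}$ of $L^2(\mathbb{R}^n;\mathbb{K})$ with $\bigcap_jV_j=\{0\}$ and $\overline{\bigcup_jV_j}=L^2$, such that $f\in V_j\Leftrightarrow f(2\,\cdot)\in V_{j+1}$, and $f\in V_0\Leftrightarrow f(\cdot-\mathbf{k})\in V_0$ for $\mathbf{k}\in\mathbb{Z}^n$. Writing $f_{(j,\mathbf{k})}(\mathbf{x})=2^{nj/2}f(2^j\mathbf{x}-\mathbf{k})$, for every $j\in\mathbb{Z}$ the family $\{\phi_{(j,\mathbf{k})}\}_{\mathbf{k}\in\mathbb{Z}^n}$ is an orthonormal basis of $V_j$, and $\{\psi_{(\epsilon,(j,\mathbf{k}))}\}_{\epsilon\in\alpha,\mathbf{k}\in\mathbb{Z}^n}$,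 with $\psi_{(\epsilon,(j,\mathbf{k}))}=(\psi_\epsilon)_{(j,\mathbf{k})}$, is an orthonormal basis of the orthogonal complement of $V_j$ in $V_{j+1}$. Moreover $\int\phi=1$ and $\int\psi_\epsilon=0$; the functions $\phi,\psi_\epsilon$ are compactly supported and of class $C^r$, and their derivatives up to order $r$ decay faster than the reciprocal of any polynomial. Let $K\subseteq\mathbb{R}^n$ be compact, $B=\operatorname{diam}(K)$, $0<s<1$, $C_0>0$, $C_1>0$. Let $\mathcal{P}_{\mathrm{ab2}}(K)$ be the set of probability measures on $K$ that are absolutely continuous with respect to Lebesgue measure with square-integrable density. For $d\mu=p_\mu d\mathbf{x}$, $d\nu=p_\nu d\mathbf{x}$ in this set put $$W_s(\mu,\nu)=\inf_{\gamma\in\Gamma(\mu,\nu)}\int|\mathbf{x}-\mathbf{y}|^s\,d\gamma(\mathbf{x},\mathbf{y}),$$ where $\Gamma(\mu,\nu)$ is the set of transport plans (couplings), and $$W^{\mathrm{wav,ori}}_s(\mu,\nu)=\sum_{\mathbf{k}\in\mathbb{Z}^n}C_0\left|\int(p_\mu-p_\nu)\,\overline{\phi_{(0,\mathbf{k})}}\,d\mathbf{x}\right|+\sum_{\epsilon\in\alpha,\,j\ge0,\,\mathbf{k}\in\mathbb{Z}^n}C_1\,2^{-j(s+n/2)}\left|\int(p_\mu-p_\nu)\,\overline{\psi_{(\epsilon,(j,\mathbf{k}))}}\,d\mathbf{x}\right|.$$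 Define $$a_{13}=\frac1{\|\phi\|_{L^1}},\qquad a_{14}=\frac1{\max_{\epsilon}\sup\left\{\left|\int f\psi_\epsilon\,d\mathbf{x}\right|\,:\,f:\mathbb{R}^n\to\mathbb{K},\ |f(\mathbf{x})-f(\mathbf{y})|\le|\mathbf{x}-\mathbf{y}|^s\right\}},$$ $$a_{21}=\sup_{\mathbf{x}\ne\mathbf{y},\ \eta}\frac{\left|\sum_{\mathbf{k}}\eta_{\mathbf{k}}\phi(\mathbf{x}-\mathbf{k})-\sum_{\mathbf{k}}\eta_{\mathbf{k}}\phi(\mathbf{y}-\mathbf{k})\right|}{|\mathbf{x}-\mathbf{y}|^s},$$ $$a_{22}=\frac{2^{1-s}}{2^{1-s}-1}\sum_{i=1}^n\ \sup_{\mathbf{x},\eta}\left|\sum_{\epsilon,\mathbf{k}}\eta_{\epsilon,\mathbf{k}}\,\partial_i\psi_\epsilon(\mathbf{x}-\mathbf{k})\right|+\frac{2}{1-2^{-s}}\ \sup_{\mathbf{x},\eta}\left|\sum_{\epsilon,\mathbf{k}}\eta_{\epsilon,\mathbf{k}}\,\psi_\epsilon(\mathbf{x}-\mathbf{k})\right|,$$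 where $\eta$ ranges over all families of scalars in $\mathbb{K}$ of modulus one (that is, of signs $\pm1$ if $\mathbb{K}=\mathbb{R}$). Then the constants $$D=\min\left(a_{13}C_0/B^s,\ a_{14}C_1\right),\qquad \tilde D=a_{21}C_0+a_{22}C_1$$ are positive and finite (if $B=0$, the first entry of the minimum is read as $+\infty$), and for all $\mu,\nu\in\mathcal{P}_{\mathrm{ab2}}(K)$ $$D\,W_s(\mu,\nu)\ \le\ W^{\mathrm{wav,ori}}_s(\mu,\nu)\ \le\ \tilde D\,W_s(\mu,\nu).$$ -/

import Mathlib

open MeasureTheory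
open scoped ENNReal NNReal

noncomputable section

namespace WaveletWasserstein

/-- The Euclidean space `ℝⁿ` (with its Euclidean norm). -/
abbrev E (n : ℕ) : Type := EuclideanSpace ℝ (Fin n)

/-- The Hilbert space `L²(ℝⁿ)` of `𝕜`-valued functions, `𝕜 = ℝ` or `ℂ`. -/
abbrev L2 (𝕜 : Type*) [RCLike 𝕜] (n : ℕ) : Type _ := Lp 𝕜 2 (volume : Measure (E n))

/-- An integer vector `k ∈ ℤⁿ`, seen as a point of `ℝⁿ`. -/
def latticePt {n : ℕ} (k : Fin n → ℤ) : E n := WithLp.toLp 2 (fun i => (k i : ℝ))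

/-- `f_{(j,k)}(x) = 2^{nj/2} f(2^j x - k)`. -/
def atom {𝕜 : Type*} [RCLike 𝕜] {n : ℕ} (f : E n → 𝕜) (j : ℤ) (k : Fin n → ℤ) : E n → 𝕜 :=
  fun x => ((2 : ℝ) ^ ((n : ℝ) * (j : ℝ) / 2)) • f (((2 : ℝ) ^ j) • x - latticePt k)

/-- `V` is a multiresolution approximation of `L²(ℝⁿ)` with scaling function `φ`. -/
structure IsMultiresolution {𝕜 : Type*} [RCLike 𝕜] {n : ℕ}
    (V : ℤ → Submodule 𝕜 (L2 𝕜 n)) (φ : E n → 𝕜) : Prop where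
  isClosed : ∀ j, IsClosed (V j : Set (L2 𝕜 n))
  mono : Monotone V
  inter : (⨅ j, V j) = ⊥
  dense : (⨆ j, V j).topologicalClosure = ⊤
  dilation : ∀ (j : ℤ) (f g : L2 𝕜 n), (g =ᵐ[volume] fun x => f ((2 : ℝ) • x)) →
    (f ∈ V j ↔ g ∈ V (j + 1))
  translation : ∀ (k : Fin n → ℤ) (f g : L2 𝕜 n),
    (g =ᵐ[volume] fun x => f (x - latticePt k)) → (f ∈ V 0 ↔ g ∈ V 0)
  integral_scaling : ∫ x, φ x = 1
  basis : ∀ j, ∃ b : HilbertBasis (Fin n → ℤ) 𝕜 (V j),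
    ∀ k, ((b k : L2 𝕜 n) : E n → 𝕜) =ᵐ[volume] atom φ j k

/-- `W_j`, the orthogonal complement of `V_j` in `V_{j+1}`. -/
def detailSpace {𝕜 : Type*} [RCLike 𝕜] {n : ℕ} (V : ℤ → Submodule 𝕜 (L2 𝕜 n)) (j : ℤ) :
    Submodule 𝕜 (L2 𝕜 n) :=
  V (j + 1) ⊓ (V j)ᗮ

/-- Orthonormal wavelet system with scaling function `φ` and wavelet functions `ψ ε`. -/
structure IsWaveletSystem {𝕜 : Type*} [RCLike 𝕜] {n : ℕ} {ι : Type*}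
    (V : ℤ → Submodule 𝕜 (L2 𝕜 n)) (φ : E n → 𝕜) (ψ : ι → E n → 𝕜) : Prop where
  multiresolution : IsMultiresolution V φ
  integrable_wavelet : ∀ ε, Integrable (ψ ε)
  integral_wavelet : ∀ ε, ∫ x, ψ ε x = 0
  basis : ∀ j, ∃ b : HilbertBasis (ι × (Fin n → ℤ)) 𝕜 (detailSpace V j),
    ∀ ε k, ((b (ε, k) : L2 𝕜 n) : E n → 𝕜) =ᵐ[volume] atom (ψ ε) j k

/-- `f` is continuously differentiable up to order `r`, and its derivatives up to order `r` decay
faster than the reciprocal of any polynomial. -/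
def IsRegular {𝕜 : Type*} [RCLike 𝕜] {n : ℕ} (r : ℕ) (f : E n → 𝕜) : Prop :=
  ContDiff ℝ r f ∧
    ∀ m ≤ r, ∀ N : ℕ, ∃ C : ℝ, ∀ x, ‖x‖ ^ N * ‖iteratedFDeriv ℝ m f x‖ ≤ C

/-- The density `p_μ` of `μ` with respect to Lebesgue measure. -/
def density {n : ℕ} (μ : Measure (E n)) : E n → ℝ := fun x => (μ.rnDeriv volume x).toReal

/-- `μ` is a probability measure on `K` which is absolutely continuous with respect to
Lebesgue measure, with a square-integrable density. -/
structure IsProbAb2 {n : ℕ} (K : Set (E n)) (μ : Measure (E n)) : Prop where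
  isProbabilityMeasure : IsProbabilityMeasure μ
  concentrated : μ Kᶜ = 0
  absolutelyContinuous : μ ≪ volume
  memLp_density : MemLp (density μ) 2 volume

/-- `W_s(μ, ν) = inf_γ ∫ |x - y|^s dγ(x, y)` over all transport plans `γ` from `μ` to `ν`
(no `1/s`-th power is taken). -/
def wasserstein {n : ℕ} (s : ℝ) (μ ν : Measure (E n)) : ℝ≥0∞ :=
  ⨅ (γ : Measure (E n × E n)) (_ : γ.map Prod.fst = μ ∧ γ.map Prod.snd = ν),
    ∫⁻ z, edist z.1 z.2 ^ s ∂γ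

/-- The coefficient `∫ (p_μ - p_ν) f_{(j,k)}^*` of `p_μ - p_ν`. For `f = φ` this is an
approximation coefficient, for `f = ψ ε` a detail coefficient. -/
def coeff {𝕜 : Type*} [RCLike 𝕜] {n : ℕ} (μ ν : Measure (E n)) (f : E n → 𝕜) (j : ℤ)
    (k : Fin n → ℤ) : 𝕜 :=
  ∫ x, ((density μ x - density ν x : ℝ) : 𝕜) * (starRingEnd 𝕜) (atom f j k x)

/-- The original wavelet `s`-Wasserstein distance with constants `C₀`, `C₁`. -/
def waveletDist {𝕜 : Type*} [RCLike 𝕜] {n : ℕ} {ι : Type*} (φ : E n → 𝕜) (ψ : ι → E n → 𝕜)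
    (C₀ C₁ : ℝ≥0) (s : ℝ) (μ ν : Measure (E n)) : ℝ≥0∞ :=
  (∑' k : Fin n → ℤ, (C₀ : ℝ≥0∞) * ‖coeff μ ν φ 0 k‖ₑ) +
    ∑' q : ι × ℕ × (Fin n → ℤ),
      (C₁ : ℝ≥0∞) * (2 : ℝ≥0∞) ^ (-(q.2.1 : ℝ) * (s + (n : ℝ) / 2)) *
        ‖coeff μ ν (ψ q.1) (q.2.1 : ℤ) q.2.2‖ₑ

/-- The operator norm of `f ↦ ∫ f g` on the homogeneous `s`-Hölder space: the supremum of
`|∫ f g|` over all `f` with `s`-Hölder constant at most `1` (used for `g` continuous with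
compact support and integral zero, so that additive constants in `f` play no role). -/
def holderDualNorm {𝕜 : Type*} [RCLike 𝕜] {n : ℕ} (s : ℝ) (g : E n → 𝕜) : ℝ≥0∞ :=
  ⨆ (f : E n → 𝕜) (_ : ∀ x y, ‖f x - f y‖ ≤ ‖x - y‖ ^ s), ‖∫ x, f x * g x‖ₑ

/-- `a₁₃(φ) = 1 / ‖φ‖_{L¹}`. -/
def a13 {𝕜 : Type*} [RCLike 𝕜] {n : ℕ} (φ : E n → 𝕜) : ℝ≥0∞ :=
  1 / eLpNorm φ 1 volume

/-- `a₁₄(ψ, s) = 1 / max_ε ‖ψ_ε‖`, with the dual norm of the homogeneous Hölder space. -/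
def a14 {𝕜 : Type*} [RCLike 𝕜] {n : ℕ} {ι : Type*} (ψ : ι → E n → 𝕜) (s : ℝ) : ℝ≥0∞ :=
  1 / ⨆ ε, holderDualNorm s (ψ ε)

/-- `a₂₁(φ, s)`: the largest `s`-Hölder constant of `∑_k η_k φ(· - k)` over all choices of
signs `η_k`. A sign is a scalar of modulus one: for `𝕜 = ℝ` these are exactly `1` and `-1`. -/
def a21 {𝕜 : Type*} [RCLike 𝕜] {n : ℕ} (φ : E n → 𝕜) (s : ℝ) : ℝ≥0∞ :=
  ⨆ (η : (Fin n → ℤ) → 𝕜) (_ : ∀ k, ‖η k‖ = 1) (x : E n) (y : E n) (_ : x ≠ y),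
    ‖(∑' k, η k * atom φ 0 k x) - ∑' k, η k * atom φ 0 k y‖ₑ / edist x y ^ s

/-- `‖∑ψ‖_∞`: the largest value of `|∑_{k,ε} η_{k,ε} ψ_ε(x - k)|` over all `x` and all signs. -/
def supSum {𝕜 : Type*} [RCLike 𝕜] {n : ℕ} {ι : Type*} (ψ : ι → E n → 𝕜) : ℝ≥0∞ :=
  ⨆ (η : ι × (Fin n → ℤ) → 𝕜) (_ : ∀ q, ‖η q‖ = 1) (x : E n),
    ‖∑' q : ι × (Fin n → ℤ), η q * atom (ψ q.1) 0 q.2 x‖ₑ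

/-- `‖∑ψ^{(i)}‖_∞`: the same with the partial derivatives `∂ψ_ε(x - k)/∂x_i`. -/
def supSumDeriv {𝕜 : Type*} [RCLike 𝕜] {n : ℕ} {ι : Type*} (ψ : ι → E n → 𝕜) (i : Fin n) :
    ℝ≥0∞ :=
  ⨆ (η : ι × (Fin n → ℤ) → 𝕜) (_ : ∀ q, ‖η q‖ = 1) (x : E n),
    ‖∑' q : ι × (Fin n → ℤ),
      η q * fderiv ℝ (atom (ψ q.1) 0 q.2) x (EuclideanSpace.single i 1)‖ₑ

/-- `a₂₂(ψ, s) = 2^{1-s} ∑_i ‖∑ψ^{(i)}‖_∞ / (2^{1-s} - 1) + 2 ‖∑ψ‖_∞ / (1 - 2^{-s})`. -/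
def a22 {𝕜 : Type*} [RCLike 𝕜] {n : ℕ} {ι : Type*} (ψ : ι → E n → 𝕜) (s : ℝ) : ℝ≥0∞ :=
  ENNReal.ofReal ((2 : ℝ) ^ (1 - s) / ((2 : ℝ) ^ (1 - s) - 1)) * ∑ i, supSumDeriv ψ i +
    ENNReal.ofReal (2 / (1 - (2 : ℝ) ^ (-s))) * supSum ψ

/-- The lower constant `min (a₁₃ C₀ / B^s) (a₁₄ C₁)`. -/
def lowerConst {𝕜 : Type*} [RCLike 𝕜] {n : ℕ} {ι : Type*} (φ : E n → 𝕜) (ψ : ι → E n → 𝕜)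
    (s : ℝ) (C₀ C₁ : ℝ≥0) (B : ℝ) : ℝ≥0∞ :=
  min (a13 φ * C₀ / ENNReal.ofReal (B ^ s)) (a14 ψ s * C₁)

/-- The upper constant `a₂₁ C₀ + a₂₂ C₁`. -/
def upperConst {𝕜 : Type*} [RCLike 𝕜] {n : ℕ} {ι : Type*} (φ : E n → 𝕜) (ψ : ι → E n → 𝕜)
    (s : ℝ) (C₀ C₁ : ℝ≥0) : ℝ≥0∞ :=
  a21 φ s * C₀ + a22 ψ s * C₁

end WaveletWasserstein

end

/-!
# Wavelet characterization of the `s`-Wasserstein distance, `0 < s < 1`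

**Upper bound.** Fix a transport plan `γ`. On each level, the sum of the moduli of the wavelet
coefficients of `p_μ - p_ν` equals, after multiplying each coefficient by a suitable scalar of modulus
one, the integral of the increment `F x - F y` of one signed superposition `F` of wavelets against `γ`
(`exists_signs_tsum_enorm_le`). A superposition of level `j` is bounded by `supSum ψ` and Lipschitz with
constant `2 ^ j ∑ i, supSumDeriv ψ i`, up to normalization. With the weights `2 ^ (-js)`, the boundedness
serves for the levels with `2 ^ j |x - y| > 1` and the Lipschitz bound for the others; two geometric
series give `a22 |x - y| ^ s` (`tsum_enorm_levels_le`). The scaling functions contribute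
`a21 |x - y| ^ s` by the definition of `a21`. Compactness of the supports makes all superpositions
locally finite, with a uniform bound on the number of terms; this also makes the constants finite.

**Lower bound.** By Kantorovich duality (`exists_coupling_dual`) for the metric `|x - y| ^ s`, the distance
is approximated by `∫ f dμ - ∫ f dν`, where `f` is `s`-Hölder with constant `1` and bounded by
`(diam K) ^ s` (`exists_holder_wasserstein_le`). The scaling functions of level `0` and the wavelets of
levels `j ≥ 0` form a Hilbert basis of `L²` (`exists_hilbertBasis_wavelet`), so that Parseval's identity
expands this pairing. The coefficients of `f` are at most `(diam K) ^ s ‖φ‖_{L¹}` against scaling functions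
and, by scaling, `2 ^ (-j (s + n / 2))` times the dual Hölder norm of `ψ_ε` against wavelets
(`enorm_integral_sub_le`).

Kantorovich duality is proved from the Hahn-Banach theorem, applied to the sublinear functional `dualCost`
on `C(X × X)`, and the Riesz-Markov-Kakutani theorem.
-/

namespace WaveletWasserstein

/-! ### Kantorovich duality on a compact space -/

/-- The supporting functional given by the Hahn-Banach theorem: a sublinear functional has a linear
minorant that agrees with it at a prescribed point. -/
theorem exists_linearMap_le_sublinear_eq {F : Type*} [AddCommGroup F] [Module ℝ F] (N : F → ℝ)
    (N_hom : ∀ c : ℝ, 0 < c → ∀ x, N (c • x) = c * N x)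
    (N_add : ∀ x y, N (x + y) ≤ N x + N y) (x₀ : F) :
    ∃ g : F →ₗ[ℝ] ℝ, g x₀ = N x₀ ∧ ∀ x, g x ≤ N x := by
  have N_0 : N 0 = 0 := by
    have := N_hom 2 (by norm_num) 0
    rw [smul_zero] at this
    linarith
  have H : ∀ c : ℝ, c • x₀ = 0 → (RingHom.id ℝ) c • N x₀ = 0 := by
    intro c hc
    rcases smul_eq_zero.1 hc with h | h
    · simp [h]
    · simp [h, N_0]
  obtain ⟨g, hg, hgN⟩ := exists_extension_of_le_sublinear
    (LinearPMap.mkSpanSingleton' (σ := RingHom.id ℝ) x₀ (N x₀) H) N N_hom N_add (by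
      rintro ⟨x, hx⟩
      obtain ⟨c, rfl⟩ := Submodule.mem_span_singleton.1 hx
      rw [LinearPMap.mkSpanSingleton'_apply]
      simp only [RingHom.id_apply, smul_eq_mul]
      rcases lt_trichotomy c 0 with h | h | h
      · have h1 := N_add (c • x₀) ((-c) • x₀)
        rw [← add_smul, add_neg_cancel, zero_smul, N_0, N_hom (-c) (by linarith)] at h1
        linarith
      · simp [h, N_0]
      · rw [N_hom c h])
  refine ⟨g, ?_, hgN⟩
  have := hg ⟨x₀, Submodule.mem_span_singleton_self x₀⟩
  exact this.trans (LinearPMap.mkSpanSingleton'_apply_self (σ := RingHom.id ℝ) x₀ (N x₀) H _)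

/-- A positive linear functional on `C(Y)`, `Y` compact, is integration against a finite measure. -/
theorem exists_measure_of_nonneg_functional {Y : Type*} [TopologicalSpace Y] [CompactSpace Y]
    [T2Space Y] [MeasurableSpace Y] [BorelSpace Y] (g : C(Y, ℝ) →ₗ[ℝ] ℝ)
    (hg : ∀ h : C(Y, ℝ), 0 ≤ h → 0 ≤ g h) :
    ∃ γ : Measure Y, IsFiniteMeasure γ ∧ ∀ h : C(Y, ℝ), ∫ y, h y ∂γ = g h := by
  let L : CompactlySupportedContinuousMap Y ℝ →ₗ[ℝ] ℝ :=
    { toFun := fun f => g f.toContinuousMap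
      map_add' := fun a b => by
        rw [← map_add]; rfl
      map_smul' := fun c a => by
        simp only [RingHom.id_apply]
        rw [← map_smul]; rfl }
  let Λ : CompactlySupportedContinuousMap Y ℝ →ₚ[ℝ] ℝ :=
    PositiveLinearMap.mk₀ L (fun f hf => hg _ hf)
  refine ⟨RealRMK.rieszMeasure Λ, ?_, fun h => ?_⟩
  · have : (RealRMK.rieszMeasure Λ).Regular := inferInstance
    infer_instance
  · have := RealRMK.integral_rieszMeasure Λ
      (CompactlySupportedContinuousMap.continuousMapEquiv h)
    exact this

/-- The infimum of `∫ u dμ + ∫ v dν` over all continuous `u`, `v` with `h (x, y) ≤ u x + v y`: the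
sublinear functional on `C(X × X)` whose linear minorants are the transport plans from `μ` to `ν`. -/
noncomputable def dualCost {X : Type*} [TopologicalSpace X] [MeasurableSpace X]
    (μ ν : Measure X) (h : C(X × X, ℝ)) : ℝ :=
  sInf {t | ∃ u v : C(X, ℝ), (∀ x y, h (x, y) ≤ u x + v y) ∧ t = ∫ x, u x ∂μ + ∫ y, v y ∂ν}

section
variable {X : Type*} [MetricSpace X] [CompactSpace X] [MeasurableSpace X] [BorelSpace X]
  (μ ν : Measure X) [IsProbabilityMeasure μ] [IsProbabilityMeasure ν]

theorem integrable_continuousMap (μ : Measure X) [IsFiniteMeasure μ] (u : C(X, ℝ)) :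
    Integrable (fun x => u x) μ :=
  u.continuous.integrable_of_hasCompactSupport (HasCompactSupport.of_compactSpace _)

theorem integral_add_integral_mono {u v u' v' : C(X, ℝ)}
    (h : ∀ x y, u x + v y ≤ u' x + v' y) :
    ∫ x, u x ∂μ + ∫ y, v y ∂ν ≤ ∫ x, u' x ∂μ + ∫ y, v' y ∂ν := by
  have key : ∀ x, u x + ∫ y, v y ∂ν ≤ u' x + ∫ y, v' y ∂ν := fun x => by
    have := integral_mono (μ := ν) ((integrable_const (u x)).add (integrable_continuousMap ν v))
      ((integrable_const (u' x)).add (integrable_continuousMap ν v')) (h x)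
    simp only [Pi.add_apply] at this
    rw [integral_add (integrable_const _) (integrable_continuousMap ν v),
      integral_add (integrable_const _) (integrable_continuousMap ν v')] at this
    simpa using this
  have := integral_mono (μ := μ) ((integrable_continuousMap μ u).add (integrable_const _))
      ((integrable_continuousMap μ u').add (integrable_const _)) key
  simp only [Pi.add_apply] at this
  rw [integral_add (integrable_continuousMap μ u) (integrable_const _),
    integral_add (integrable_continuousMap μ u') (integrable_const _)] at this
  simpa using this

theorem neg_norm_le_integral_add_integral {h : C(X × X, ℝ)} {u v : C(X, ℝ)}
    (huv : ∀ x y, h (x, y) ≤ u x + v y) :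
    -‖h‖ ≤ ∫ x, u x ∂μ + ∫ y, v y ∂ν := by
  have := integral_add_integral_mono μ ν (u := ContinuousMap.const X (-‖h‖))
    (v := ContinuousMap.const X 0) (u' := u) (v' := v) (fun x y => by
      have h1 := huv x y
      have h2 := (abs_le.1 (h.norm_coe_le_norm (x, y))).1
      simp only [ContinuousMap.const_apply]
      linarith)
  simpa using this

theorem dualCost_le {h : C(X × X, ℝ)} {u v : C(X, ℝ)}
    (huv : ∀ x y, h (x, y) ≤ u x + v y) :
    dualCost μ ν h ≤ ∫ x, u x ∂μ + ∫ y, v y ∂ν :=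
  csInf_le ⟨-‖h‖, by rintro _ ⟨u, v, huv, rfl⟩; exact neg_norm_le_integral_add_integral μ ν huv⟩
    ⟨u, v, huv, rfl⟩

omit [BorelSpace X] [IsProbabilityMeasure μ] [IsProbabilityMeasure ν] in
theorem exists_lt_dualCost_add (h : C(X × X, ℝ)) {ε : ℝ} (hε : 0 < ε) :
    ∃ u v : C(X, ℝ), (∀ x y, h (x, y) ≤ u x + v y) ∧
      ∫ x, u x ∂μ + ∫ y, v y ∂ν < dualCost μ ν h + ε := by
  obtain ⟨t, ⟨u, v, huv, rfl⟩, ht⟩ := Real.lt_sInf_add_pos (s := {t | ∃ u v : C(X, ℝ),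
    (∀ x y, h (x, y) ≤ u x + v y) ∧ t = ∫ x, u x ∂μ + ∫ y, v y ∂ν}) (by
      refine ⟨_, ContinuousMap.const X ‖h‖, ContinuousMap.const X 0, fun x y => ?_, rfl⟩
      simpa using (abs_le.1 (h.norm_coe_le_norm (x, y))).2) hε
  exact ⟨u, v, huv, ht⟩

theorem dualCost_add_le (h k : C(X × X, ℝ)) :
    dualCost μ ν (h + k) ≤ dualCost μ ν h + dualCost μ ν k := by
  refine le_of_forall_pos_le_add fun ε hε => ?_
  obtain ⟨u, v, huv, h1⟩ := exists_lt_dualCost_add μ ν h (half_pos hε)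
  obtain ⟨u', v', huv', h2⟩ := exists_lt_dualCost_add μ ν k (half_pos hε)
  have := dualCost_le μ ν (h := h + k) (u := u + u') (v := v + v') (fun x y => by
    have := huv x y
    have := huv' x y
    simp only [ContinuousMap.add_apply]
    linarith)
  simp only [ContinuousMap.add_apply] at this
  rw [integral_add (integrable_continuousMap μ u) (integrable_continuousMap μ u'),
    integral_add (integrable_continuousMap ν v) (integrable_continuousMap ν v')] at this
  linarith

theorem dualCost_smul_le {c : ℝ} (hc : 0 < c) (h : C(X × X, ℝ)) :
    dualCost μ ν (c • h) ≤ c * dualCost μ ν h := by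
  refine le_of_forall_pos_le_add fun ε hε => ?_
  obtain ⟨u, v, huv, h1⟩ := exists_lt_dualCost_add μ ν h (div_pos hε hc)
  have := dualCost_le μ ν (h := c • h) (u := c • u) (v := c • v) (fun x y => by
    have := mul_le_mul_of_nonneg_left (huv x y) hc.le
    simp only [ContinuousMap.smul_apply, smul_eq_mul]
    linarith)
  simp only [ContinuousMap.smul_apply, smul_eq_mul, integral_const_mul] at this
  have h2 := mul_lt_mul_of_pos_left h1 hc
  rw [mul_add, mul_add, mul_div_cancel₀ _ hc.ne'] at h2
  linarith

theorem dualCost_smul {c : ℝ} (hc : 0 < c) (h : C(X × X, ℝ)) :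
    dualCost μ ν (c • h) = c * dualCost μ ν h := by
  refine le_antisymm (dualCost_smul_le μ ν hc h) ?_
  have := dualCost_smul_le μ ν (inv_pos.2 hc) (c • h)
  rw [smul_smul, inv_mul_cancel₀ hc.ne', one_smul] at this
  have h2 := mul_le_mul_of_nonneg_left this hc.le
  rwa [mul_inv_cancel_left₀ hc.ne'] at h2

/-- **Kantorovich duality** on a compact metric space: some transport plan costs no more than the
supremum of `∫ u dμ + ∫ v dν` over `u x + v y ≤ c (x, y)`. -/
theorem exists_coupling_dual (c : C(X × X, ℝ)) :
    ∃ γ : Measure (X × X), γ.map Prod.fst = μ ∧ γ.map Prod.snd = ν ∧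
      ∀ ε > 0, ∃ u v : C(X, ℝ), (∀ x y, u x + v y ≤ c (x, y)) ∧
        ∫ z, c z ∂γ < ∫ x, u x ∂μ + ∫ y, v y ∂ν + ε := by
  obtain ⟨g, hg0, hg⟩ := exists_linearMap_le_sublinear_eq (dualCost μ ν)
    (fun c hc x => dualCost_smul μ ν hc x) (dualCost_add_le μ ν) (-c)
  -- The functional is at most, hence equal to, `∫ u dμ + ∫ v dν` on `(x, y) ↦ u x + v y`:
  -- the inequality may be applied to `-u` and `-v`.
  have hsum : ∀ u v : C(X, ℝ), g (u.comp ⟨Prod.fst, continuous_fst⟩ +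
      v.comp ⟨Prod.snd, continuous_snd⟩) ≤ ∫ x, u x ∂μ + ∫ y, v y ∂ν := fun u v =>
    (hg _).trans (dualCost_le μ ν fun x y => le_rfl)
  have hfst : ∀ u : C(X, ℝ), g (u.comp ⟨Prod.fst, continuous_fst⟩) = ∫ x, u x ∂μ := by
    intro u
    have h1 := hsum u 0
    have h2 := hsum (-u) 0
    have e : (-u).comp (⟨Prod.fst, continuous_fst⟩ : C(X × X, X))
      = -(u.comp ⟨Prod.fst, continuous_fst⟩) := rfl
    rw [e] at h2
    simp only [ContinuousMap.zero_comp, add_zero, map_neg, ContinuousMap.neg_apply,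
      integral_neg, ContinuousMap.zero_apply, integral_zero] at h1 h2
    linarith
  have hsnd : ∀ u : C(X, ℝ), g (u.comp ⟨Prod.snd, continuous_snd⟩) = ∫ x, u x ∂ν := by
    intro u
    have h1 := hsum 0 u
    have h2 := hsum 0 (-u)
    have e : (-u).comp (⟨Prod.snd, continuous_snd⟩ : C(X × X, X))
      = -(u.comp ⟨Prod.snd, continuous_snd⟩) := rfl
    rw [e] at h2
    simp only [ContinuousMap.zero_comp, zero_add, map_neg, ContinuousMap.neg_apply,
      integral_neg, ContinuousMap.zero_apply, integral_zero] at h1 h2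
    linarith
  obtain ⟨γ, hγ, hγg⟩ := exists_measure_of_nonneg_functional g (fun h hh => by
    have h1 := hg (-h)
    have h2 := dualCost_le μ ν (h := -h) (u := 0) (v := 0) (fun x y => by simpa using hh (x, y))
    simp only [map_neg, ContinuousMap.zero_apply, integral_zero, add_zero] at h1 h2
    linarith)
  refine ⟨γ, ?_, ?_, fun ε hε => ?_⟩
  · refine ext_of_forall_integral_eq_of_IsFiniteMeasure fun f => ?_
    rw [integral_map measurable_fst.aemeasurable f.continuous.aestronglyMeasurable]
    exact (hγg _).trans (hfst f.toContinuousMap)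
  · refine ext_of_forall_integral_eq_of_IsFiniteMeasure fun f => ?_
    rw [integral_map measurable_snd.aemeasurable f.continuous.aestronglyMeasurable]
    exact (hγg _).trans (hsnd f.toContinuousMap)
  · obtain ⟨u, v, huv, h1⟩ := exists_lt_dualCost_add μ ν (-c) hε
    refine ⟨-u, -v, fun x y => ?_, ?_⟩
    · have := huv x y
      simp only [ContinuousMap.neg_apply] at this ⊢
      linarith
    · rw [hγg]
      simp only [ContinuousMap.neg_apply, integral_neg]
      rw [map_neg] at hg0
      linarith

end

/-! ### Hölder potentials for the cost `|x - y| ^ s` -/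

theorem dist_rpow_triangle {X : Type*} [PseudoMetricSpace X] {s : ℝ} (hs0 : 0 ≤ s) (hs1 : s ≤ 1)
    (x y z : X) : dist x z ^ s ≤ dist x y ^ s + dist y z ^ s :=
  (Real.rpow_le_rpow dist_nonneg (dist_triangle x y z) hs0).trans
    (Real.rpow_add_le_add_rpow dist_nonneg dist_nonneg hs0 hs1)

theorem continuous_of_abs_sub_le_dist_rpow {X F : Type*} [PseudoMetricSpace X]
    [SeminormedAddCommGroup F] {s : ℝ} (hs0 : 0 < s)
    {f : X → F} (hf : ∀ x y, ‖f x - f y‖ ≤ dist x y ^ s) : Continuous f := by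
  have : HolderWith 1 ⟨s, hs0.le⟩ f := by
    intro x y
    rw [edist_dist, edist_dist, dist_eq_norm, ENNReal.coe_one, one_mul,
      ENNReal.ofReal_rpow_of_nonneg dist_nonneg (by exact hs0.le)]
    exact ENNReal.ofReal_le_ofReal (hf x y)
  exact this.continuous (by exact_mod_cast hs0)

/-- A dual pair `(u, v)` for the cost `dist ^ s` is improved by a single function `f`, up to an
additive constant `m`: `u ≤ f + m ≤ -v` on `K`, where `f` is `s`-Hölder with constant `1` on the whole
space and bounded by `diam K ^ s`. It is the transform `x ↦ inf_y (dist x y ^ s - v y)`, normalized to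
have minimum `0` on `K` and truncated at `diam K ^ s`, a value it does not exceed on `K`. -/
theorem exists_potential {X : Type*} [MetricSpace X] {K : Set X} (hK : IsCompact K)
    (hKne : K.Nonempty) {s : ℝ} (hs0 : 0 < s) (hs1 : s ≤ 1) (u v : C(K, ℝ))
    (huv : ∀ x y : K, u x + v y ≤ dist x y ^ s) :
    ∃ (f : X → ℝ) (m : ℝ), (∀ x y, |f x - f y| ≤ dist x y ^ s) ∧
      (∀ x, |f x| ≤ Metric.diam K ^ s) ∧ ∀ x : K, u x ≤ f x + m ∧ f x + m ≤ - v x := by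
  have : CompactSpace K := isCompact_iff_compactSpace.1 hK
  have : Nonempty K := hKne.to_subtype
  let h : X → ℝ := fun x => ⨅ y : K, (dist x y ^ s - v y)
  have hbdd : ∀ x : X, BddBelow (Set.range fun y : K => dist x (y : X) ^ s - v y) := fun x => by
    refine ⟨-‖v‖, ?_⟩
    rintro _ ⟨y, rfl⟩
    have h1 := (abs_le.1 (v.norm_coe_le_norm y)).2
    have h2 : 0 ≤ dist x (y : X) ^ s := by positivity
    simp only
    linarith
  have hle : ∀ x y, h x ≤ h y + dist x y ^ s := fun x y => by
    rw [← sub_le_iff_le_add]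
    refine le_ciInf fun z => ?_
    have h1 : h x ≤ dist x (z : X) ^ s - v z := ciInf_le (hbdd x) z
    have h2 := dist_rpow_triangle hs0.le hs1 x y (z : X)
    linarith
  have habs : ∀ x y, |h x - h y| ≤ dist x y ^ s := fun x y => by
    rw [abs_le]
    have h1 := hle x y
    have h2 := hle y x
    rw [dist_comm] at h2
    constructor <;> linarith
  have hcont : Continuous h := continuous_of_abs_sub_le_dist_rpow hs0 habs
  obtain ⟨x₀, hx₀, hmin⟩ := hK.exists_isMinOn hKne hcont.continuousOn
  have hB : 0 ≤ Metric.diam K ^ s := by positivity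
  refine ⟨fun x => max 0 (min (h x - h x₀) (Metric.diam K ^ s)), h x₀, fun x y => ?_,
    fun x => ?_, fun x => ?_⟩
  · refine (abs_max_sub_max_le_max _ _ _ _).trans ?_
    rw [sub_self, abs_zero, max_eq_right (abs_nonneg _)]
    refine (abs_min_sub_min_le_max _ _ _ _).trans ?_
    rw [sub_self, abs_zero, max_eq_left (abs_nonneg _)]
    simpa using habs x y
  · rw [abs_of_nonneg (le_max_left _ _)]
    exact max_le hB (min_le_right _ _)
  · have h1 : h x₀ ≤ h x := hmin x.2
    have h2 : h x - h x₀ ≤ Metric.diam K ^ s := by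
      have := hle x x₀
      have h3 := Real.rpow_le_rpow dist_nonneg
        (Metric.dist_le_diam_of_mem hK.isBounded x.2 hx₀) hs0.le
      linarith
    simp only
    rw [min_eq_left h2, max_eq_right (by linarith), sub_add_cancel]
    constructor
    · refine le_ciInf fun y => ?_
      have := huv x y
      rw [Subtype.dist_eq] at this
      linarith
    · have := ciInf_le (hbdd x) x
      simpa [Real.zero_rpow hs0.ne'] using this

/-- Kantorovich-Rubinstein duality for the cost `|x - y| ^ s` on a compact set, with an error `ε`. -/
theorem exists_holder_wasserstein_le {n : ℕ} {K : Set (E n)} (hK : IsCompact K) {s : ℝ}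
    (hs0 : 0 < s) (hs1 : s ≤ 1) (μ ν : Measure (E n)) [IsProbabilityMeasure μ]
    [IsProbabilityMeasure ν] (hμ : μ Kᶜ = 0) (hν : ν Kᶜ = 0) {ε : ℝ} (hε : 0 < ε) :
    ∃ f : E n → ℝ, (∀ x y, |f x - f y| ≤ ‖x - y‖ ^ s) ∧
      (∀ x, |f x| ≤ Metric.diam K ^ s) ∧
      wasserstein s μ ν ≤ ENNReal.ofReal (∫ x, f x ∂μ - ∫ x, f x ∂ν + ε) := by
  have hKne : K.Nonempty := by
    by_contra h
    rw [Set.not_nonempty_iff_eq_empty] at h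
    simp [h] at hμ
  have hcs : CompactSpace K := isCompact_iff_compactSpace.1 hK
  have hemb := MeasurableEmbedding.subtype_coe hK.measurableSet
  have hpres : ∀ ρ : Measure (E n), ρ Kᶜ = 0 →
      (ρ.comap ((↑) : K → E n)).map ((↑) : K → E n) = ρ := fun ρ hρ => by
    rw [hemb.map_comap, Subtype.range_coe]
    exact Measure.restrict_eq_self_of_ae_mem (by rwa [ae_iff])
  have hprob : ∀ ρ : Measure (E n), IsProbabilityMeasure ρ → ρ Kᶜ = 0 →
      IsProbabilityMeasure (ρ.comap ((↑) : K → E n)) := fun ρ hp hρ => by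
    have : IsProbabilityMeasure ((ρ.comap ((↑) : K → E n)).map ((↑) : K → E n)) := by
      rwa [hpres ρ hρ]
    exact Measure.isProbabilityMeasure_of_map ((↑) : K → E n)
  have := hprob μ inferInstance hμ
  have := hprob ν inferInstance hν
  have hcc : Continuous fun z : K × K => dist z.1 z.2 ^ s :=
    (continuous_fst.dist continuous_snd).rpow_const fun _ => Or.inr hs0.le
  obtain ⟨γ, hγ1, hγ2, hγ⟩ := exists_coupling_dual (μ.comap ((↑) : K → E n))
    (ν.comap ((↑) : K → E n)) ⟨_, hcc⟩
  obtain ⟨u, v, huv, hlt⟩ := hγ ε hε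
  obtain ⟨f, m, hf, hfB, hfuv⟩ := exists_potential hK hKne hs0 hs1 u v huv
  have hfcont : Continuous f := continuous_of_abs_sub_le_dist_rpow hs0 hf
  have hint : ∀ ρ : Measure (E n), ρ Kᶜ = 0 →
      ∫ x, f x ∂ρ = ∫ x : K, f x ∂(ρ.comap ((↑) : K → E n)) := fun ρ hρ => by
    conv_lhs => rw [← hpres ρ hρ]
    rw [hemb.integral_map]
  let fK : C(K, ℝ) := ⟨fun x => f x, hfcont.comp continuous_subtype_val⟩
  refine ⟨f, by simpa only [dist_eq_norm] using hf, hfB, ?_⟩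
  have : IsProbabilityMeasure (γ.map Prod.fst) := by rw [hγ1]; infer_instance
  have hpf : IsProbabilityMeasure γ := Measure.isProbabilityMeasure_of_map Prod.fst
  have hmeas : Measurable (Prod.map ((↑) : K → E n) ((↑) : K → E n)) :=
    measurable_subtype_coe.prodMap measurable_subtype_coe
  refine (iInf₂_le (γ.map (Prod.map (↑) (↑))) (⟨?_, ?_⟩ : _ ∧ _)).trans ?_
  · rw [Measure.map_map measurable_fst hmeas,
      show Prod.fst ∘ Prod.map ((↑) : K → E n) ((↑) : K → E n) = (↑) ∘ Prod.fst from rfl,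
      ← Measure.map_map measurable_subtype_coe measurable_fst, hγ1, hpres μ hμ]
  · rw [Measure.map_map measurable_snd hmeas,
      show Prod.snd ∘ Prod.map ((↑) : K → E n) ((↑) : K → E n) = (↑) ∘ Prod.snd from rfl,
      ← Measure.map_map measurable_subtype_coe measurable_snd, hγ2, hpres ν hν]
  · have hm2 : Measurable fun z : E n × E n => edist z.1 z.2 ^ s := by fun_prop
    rw [lintegral_map hm2 hmeas]
    have e : ∀ z : K × K, edist (Prod.map ((↑) : K → E n) ((↑) : K → E n) z).1
        (Prod.map ((↑) : K → E n) ((↑) : K → E n) z).2 ^ s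
        = ENNReal.ofReal (dist z.1 z.2 ^ s) := fun z => by
      rw [← ENNReal.ofReal_rpow_of_nonneg dist_nonneg hs0.le, ← edist_dist]
      rfl
    simp_rw [e]
    rw [← ofReal_integral_eq_lintegral_ofReal
      (hcc.integrable_of_hasCompactSupport (HasCompactSupport.of_compactSpace _))
      (Filter.Eventually.of_forall fun z => by positivity)]
    refine ENNReal.ofReal_le_ofReal ?_
    have h1 : ∫ x, u x ∂(μ.comap ((↑) : K → E n)) ≤ ∫ x, f x ∂μ + m := by
      rw [hint μ hμ]
      have := integral_mono (integrable_continuousMap _ u)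
        ((integrable_continuousMap (μ.comap ((↑) : K → E n)) fK).add (integrable_const m))
        (fun x => (hfuv x).1)
      simp only [Pi.add_apply] at this
      rw [integral_add (integrable_continuousMap _ fK) (integrable_const _)] at this
      simpa [fK] using this
    have h2 : ∫ x, v x ∂(ν.comap ((↑) : K → E n)) ≤ -(∫ x, f x ∂ν + m) := by
      rw [hint ν hν]
      have := integral_mono
        ((integrable_continuousMap (ν.comap ((↑) : K → E n)) fK).add (integrable_const m))
        (integrable_continuousMap _ v).neg
        (fun x => (hfuv x).2)
      simp only [Pi.add_apply, Pi.neg_apply] at this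
      rw [integral_add (integrable_continuousMap _ fK) (integrable_const _), integral_neg] at this
      rw [le_neg]
      simpa [fK] using this
    simp only [ContinuousMap.coe_mk] at hlt
    linarith

/-! ### The orthonormal basis of `L²` given by a wavelet system -/

section
variable {𝕜 : Type*} [RCLike 𝕜] {n : ℕ} {ι : Type*} {V : ℤ → Submodule 𝕜 (L2 𝕜 n)}
  {φ : E n → 𝕜} {ψ : ι → E n → 𝕜}

theorem mem_orthogonal_of_hilbertBasis {H J : Type*} [NormedAddCommGroup H]
    [InnerProductSpace 𝕜 H] {U : Submodule 𝕜 H} [CompleteSpace U] (c : HilbertBasis J 𝕜 U)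
    (x : H) (hx : ∀ i, inner 𝕜 ((c i : U) : H) x = 0) : x ∈ Uᗮ := by
  intro u hu
  have hz : U.orthogonalProjectionOnto x = 0 := by
    refine c.repr.injective ?_
    ext i
    rw [HilbertBasis.repr_apply_apply, map_zero, lp.coeFn_zero, Pi.zero_apply,
      Submodule.inner_orthogonalProjectionOnto_eq_of_mem_left]
    exact hx i
  have := Submodule.inner_orthogonalProjectionOnto_eq_of_mem_left (K := U) ⟨u, hu⟩ x
  rw [hz, inner_zero_right] at this
  exact this.symm

theorem detailSpace_isOrtho_detailSpace (hmono : Monotone V) {i j : ℤ} (hij : i < j) :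
    detailSpace V i ⟂ detailSpace V j := by
  rw [Submodule.isOrtho_iff_inner_eq]
  intro u hu v hv
  exact (Submodule.mem_orthogonal _ _).1 hv.2 u (hmono (by omega : i + 1 ≤ j) hu.1)

/-- A vector orthogonal to `V j` and to `W j` is orthogonal to `V (j + 1)`. -/
theorem mem_orthogonal_succ {j : ℤ} (hcl : IsClosed (V j : Set (L2 𝕜 n))) (hle : V j ≤ V (j + 1))
    {h : L2 𝕜 n} (h1 : h ∈ (V j)ᗮ) (h2 : h ∈ (detailSpace V j)ᗮ) : h ∈ (V (j + 1))ᗮ := by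
  have : CompleteSpace (V j) := hcl.completeSpace_coe
  intro v hv
  have hp : (V j).starProjection v ∈ V j := Submodule.starProjection_apply_mem _ _
  have hd : v - (V j).starProjection v ∈ detailSpace V j :=
    ⟨Submodule.sub_mem _ hv (hle hp), Submodule.sub_starProjection_mem_orthogonal v⟩
  rw [← sub_add_cancel v ((V j).starProjection v), inner_add_left, h1 _ hp, h2 _ hd, add_zero]

/-- An element orthogonal to `V 0` and to all `W j`, `j ≥ 0`, vanishes. -/
theorem eq_zero_of_mem_orthogonal (hM : IsMultiresolution V φ) {h : L2 𝕜 n}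
    (h0 : h ∈ (V 0)ᗮ) (hj : ∀ j : ℕ, h ∈ (detailSpace V (j : ℤ))ᗮ) : h = 0 := by
  have hnat : ∀ j : ℕ, h ∈ (V (j : ℤ))ᗮ := by
    intro j
    induction j with
    | zero => exact h0
    | succ j ih =>
      have := mem_orthogonal_succ (hM.isClosed j) (hM.mono (by omega)) ih (hj j)
      exact_mod_cast this
  have hsup : h ∈ (⨆ j, V j)ᗮ := by
    rw [← Submodule.iInf_orthogonal, Submodule.mem_iInf]
    intro j
    exact Submodule.orthogonal_le (hM.mono (Int.self_le_toNat j)) (hnat j.toNat)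
  rw [← Submodule.orthogonal_closure, hM.dense, Submodule.top_orthogonal_eq_bot] at hsup
  exact hsup

/-- Without wavelets all `V j` would coincide, and would be both trivial and dense. -/
theorem nonempty_of_isWaveletSystem (h : IsWaveletSystem V φ ψ) : Nonempty ι := by
  by_contra hι
  rw [not_nonempty_iff] at hι
  have hM := h.multiresolution
  have hW : ∀ j, detailSpace V j = ⊥ := fun j => by
    obtain ⟨b, -⟩ := h.basis j
    rw [← Submodule.subsingleton_iff_eq_bot]
    refine ⟨fun x y => b.repr.injective ?_⟩
    ext i
    exact isEmptyElim i.1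
  have hV : ∀ j, V (j + 1) = V j := fun j => by
    have : CompleteSpace (V j) := (hM.isClosed j).completeSpace_coe
    refine le_antisymm (fun v hv => ?_) (hM.mono (by omega))
    have hd : v - (V j).starProjection v ∈ detailSpace V j :=
      ⟨Submodule.sub_mem _ hv (hM.mono (by omega) (Submodule.starProjection_apply_mem _ _)),
        Submodule.sub_starProjection_mem_orthogonal v⟩
    rw [hW, Submodule.mem_bot, sub_eq_zero] at hd
    rw [hd]
    exact Submodule.starProjection_apply_mem _ _
  have hV0 : ∀ j, V j = V 0 := fun j => by
    induction j using Int.induction_on with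
    | zero => rfl
    | succ i ih => rw [hV, ih]
    | pred i ih => rw [← ih, ← hV (-(i : ℤ) - 1), sub_add_cancel]
  have hbot : V 0 = ⊥ := by
    rw [← hM.inter]
    simp [hV0]
  obtain ⟨b, -⟩ := hM.basis 0
  have h1 := b.orthonormal.norm_eq_one 0
  have h2 : (b 0 : V 0) = 0 := by
    have h3 : ∀ x ∈ V 0, x = 0 := fun x hx => by rwa [hbot, Submodule.mem_bot] at hx
    exact Subtype.ext (h3 _ (b 0).2)
  rw [h2, norm_zero] at h1
  exact zero_ne_one h1

/-- The scaling functions of level `0` and the wavelets of all levels `j ≥ 0` form an orthonormal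
basis of `L²(ℝⁿ)`. -/
theorem exists_hilbertBasis_wavelet (h : IsWaveletSystem V φ ψ) :
    ∃ b : HilbertBasis ((Fin n → ℤ) ⊕ (ι × ℕ × (Fin n → ℤ))) 𝕜 (L2 𝕜 n),
      (∀ k, (b (.inl k) : E n → 𝕜) =ᵐ[volume] atom φ 0 k) ∧
      ∀ q, (b (.inr q) : E n → 𝕜) =ᵐ[volume] atom (ψ q.1) (q.2.1 : ℤ) q.2.2 := by
  have hM := h.multiresolution
  obtain ⟨b₀, hb₀⟩ := hM.basis 0
  choose b hb using h.basis
  let e : (Fin n → ℤ) ⊕ (ι × ℕ × (Fin n → ℤ)) → L2 𝕜 n :=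
    Sum.elim (fun k => (b₀ k : L2 𝕜 n)) (fun q => (b q.2.1 (q.1, q.2.2) : L2 𝕜 n))
  have hdiff : ∀ i j : ℕ, i ≠ j → detailSpace V (i : ℤ) ⟂ detailSpace V (j : ℤ) := by
    intro i j hij
    rcases hij.lt_or_gt with hlt | hlt
    · exact detailSpace_isOrtho_detailSpace hM.mono (by exact_mod_cast hlt)
    · exact (detailSpace_isOrtho_detailSpace hM.mono (by exact_mod_cast hlt)).symm
  have h0j : ∀ j : ℕ, V 0 ⟂ detailSpace V (j : ℤ) := by
    intro j
    rw [Submodule.isOrtho_iff_inner_eq]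
    intro u hu v hv
    exact (Submodule.mem_orthogonal _ _).1 hv.2 u (hM.mono (by omega : (0 : ℤ) ≤ j) hu)
  have hon : Orthonormal 𝕜 e := by
    constructor
    · rintro (k | q)
      · exact b₀.orthonormal.norm_eq_one k
      · exact (b q.2.1).orthonormal.norm_eq_one _
    · rintro (k | ⟨ε, j, k⟩) (k' | ⟨ε', j', k'⟩) hne
      · exact b₀.orthonormal.inner_eq_zero (fun hk => hne (by rw [hk]))
      · exact Submodule.isOrtho_iff_inner_eq.1 (h0j j') _ (b₀ k).2 _ (b j' (ε', k')).2
      · exact Submodule.isOrtho_iff_inner_eq.1 (h0j j).symm _ (b j (ε, k)).2 _ (b₀ k').2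
      · by_cases hj : j = j'
        · subst hj
          exact (b j).orthonormal.inner_eq_zero (i := (ε, k)) (j := (ε', k'))
            (fun hk => hne (by simp only [Prod.mk.injEq] at hk; rw [hk.1, hk.2]))
        · exact Submodule.isOrtho_iff_inner_eq.1 (hdiff j j' hj) _ (b j (ε, k)).2 _
            (b j' (ε', k')).2
  have hclW : ∀ j, IsClosed (detailSpace V j : Set (L2 𝕜 n)) := fun j =>
    (hM.isClosed (j + 1)).inter (Submodule.isClosed_orthogonal _)
  have hspan : (Submodule.span 𝕜 (Set.range e))ᗮ = ⊥ := by
    rw [eq_bot_iff]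
    intro x hx
    have hxe : ∀ i, inner 𝕜 (e i) x = 0 := fun i =>
      hx _ (Submodule.subset_span ⟨i, rfl⟩)
    have : CompleteSpace (V 0) := (hM.isClosed 0).completeSpace_coe
    refine eq_zero_of_mem_orthogonal hM (mem_orthogonal_of_hilbertBasis b₀ x fun k => hxe (.inl k)) fun j => ?_
    have : CompleteSpace (detailSpace V (j : ℤ)) := (hclW j).completeSpace_coe
    exact mem_orthogonal_of_hilbertBasis (b j) x fun q => hxe (.inr (q.1, j, q.2))
  refine ⟨HilbertBasis.mkOfOrthogonalEqBot hon hspan, fun k => ?_, fun q => ?_⟩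
  · rw [HilbertBasis.coe_mkOfOrthogonalEqBot]
    exact hb₀ k
  · rw [HilbertBasis.coe_mkOfOrthogonalEqBot]
    exact hb _ _ _

end

/-! ### Lattice translates, and finiteness and positivity of the constants -/

section
variable {𝕜 : Type*} [RCLike 𝕜] {n : ℕ} {ι : Type*}

theorem atom_zero (f : E n → 𝕜) (k : Fin n → ℤ) (x : E n) :
    atom f 0 k x = f (x - latticePt k) := by
  simp [atom]

theorem atom_eq (f : E n → 𝕜) (j : ℤ) (k : Fin n → ℤ) (x : E n) :
    atom f j k x = ((2 : ℝ) ^ ((n : ℝ) * (j : ℝ) / 2)) • atom f 0 k (((2 : ℝ) ^ j) • x) := by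
  rw [atom_zero, atom]

theorem finite_norm_latticePt_le (R : ℝ) : {k : Fin n → ℤ | ‖latticePt k‖ ≤ R}.Finite := by
  refine (Set.Finite.pi' (t := fun _ : Fin n => Set.Icc (-⌈R⌉) ⌈R⌉)
    fun _ => Set.finite_Icc _ _).subset fun k hk i => ?_
  have h1 : ‖(latticePt k : E n) i‖ ≤ R := (PiLp.norm_apply_le _ i).trans hk
  have h2 : |(k i : ℝ)| ≤ R := h1
  have h3 := abs_le.1 (h2.trans (Int.le_ceil R))
  constructor
  · exact_mod_cast h3.1
  · exact_mod_cast h3.2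

theorem latticePt_zero : (latticePt (0 : Fin n → ℤ) : E n) = 0 := by
  ext i
  simp [latticePt]

theorem latticePt_sub (k m : Fin n → ℤ) : (latticePt (k - m) : E n) = latticePt k - latticePt m := by
  ext i
  simp [latticePt]

/-- At any point, the number of integer translates that can meet it is bounded. -/
theorem exists_card_lattice_near_le (n : ℕ) (R : ℝ) : ∃ N : ℕ, ∀ x : E n,
    ∃ T : Finset (Fin n → ℤ), T.card ≤ N ∧ ∀ k ∉ T, R < ‖x - latticePt k‖ := by
  obtain ⟨M, hM⟩ : ∃ M : ℝ, ∀ x : E n, ‖x - latticePt (fun i => ⌊x i⌋)‖ ≤ M := by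
    refine ⟨√(∑ _i : Fin n, 1), fun x => ?_⟩
    rw [EuclideanSpace.norm_eq]
    refine Real.sqrt_le_sqrt (Finset.sum_le_sum fun i _ => ?_)
    have e : (x - latticePt (fun i => ⌊x i⌋)) i = Int.fract (x i) := rfl
    rw [e, Real.norm_eq_abs, abs_of_nonneg (Int.fract_nonneg _)]
    exact pow_le_one₀ (Int.fract_nonneg _) (Int.fract_lt_one _).le
  -- Translating by the integer part of `x` reduces to a fixed bounded set of lattice points.
  let A := (finite_norm_latticePt_le (n := n) (R + M)).toFinset
  refine ⟨A.card, fun x => ⟨A.image fun k => k + fun i => ⌊x i⌋, Finset.card_image_le,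
    fun k hk => ?_⟩⟩
  by_contra! hle
  refine hk (Finset.mem_image.2 ⟨k - fun i => ⌊x i⌋, ?_, sub_add_cancel _ _⟩)
  rw [Set.Finite.mem_toFinset, Set.mem_ofPred_eq, latticePt_sub]
  calc ‖(latticePt k : E n) - latticePt fun i => ⌊x i⌋‖
      = ‖(x - latticePt fun i => ⌊x i⌋) - (x - latticePt k)‖ := by congr 1; abel
    _ ≤ _ := norm_sub_le _ _
    _ ≤ R + M := by linarith [hM x]

/-- A common radius for finitely many compact supports. -/
theorem exists_radius_of_hasCompactSupport [Finite ι] {F : Type*} [Zero F] [TopologicalSpace F]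
    {f : ι → E n → F} (hf : ∀ ε, HasCompactSupport (f ε)) :
    ∃ R : ℝ, 0 ≤ R ∧ ∀ ε x, R < ‖x‖ → x ∉ tsupport (f ε) := by
  have hb : Bornology.IsBounded (⋃ ε, tsupport (f ε)) :=
    (isCompact_iUnion hf).isBounded
  obtain ⟨R, hR⟩ := hb.subset_closedBall 0
  refine ⟨max R 0, le_max_right _ _, fun ε x hx h => ?_⟩
  have := hR (Set.mem_iUnion.2 ⟨ε, h⟩)
  rw [mem_closedBall_zero_iff] at this
  exact absurd hx (not_lt.2 (this.trans (le_max_left _ _)))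

theorem exists_forall_norm_le_of_hasCompactSupport [Finite ι] {F : Type*} [NormedAddCommGroup F]
    {f : ι → E n → F} (hf : ∀ ε, HasCompactSupport (f ε)) (hc : ∀ ε, Continuous (f ε)) :
    ∃ M : ℝ, 0 ≤ M ∧ ∀ ε x, ‖f ε x‖ ≤ M := by
  cases nonempty_fintype ι
  choose M hM using fun ε => (hc ε).bounded_above_of_compact_support (hf ε)
  refine ⟨∑ ε, max (M ε) 0, Finset.sum_nonneg fun _ _ => le_max_right _ _, fun ε x => ?_⟩
  exact ((hM ε x).trans (le_max_left _ 0)).trans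
    (Finset.single_le_sum (f := fun ε => max (M ε) 0) (fun _ _ => le_max_right _ _)
      (Finset.mem_univ ε))

/-- At any point, the number of integer translates of the `f ε` whose support contains it is at most
`N`, uniformly in the point. -/
theorem exists_finset_forall_notMem_eq_zero [Finite ι] {f : ι → E n → 𝕜}
    (hf : ∀ ε, HasCompactSupport (f ε)) :
    ∃ N : ℕ, ∀ x : E n, ∃ T : Finset (ι × (Fin n → ℤ)), T.card ≤ N ∧
      ∀ q ∉ T, x - latticePt q.2 ∉ tsupport (f q.1) := by
  cases nonempty_fintype ι
  obtain ⟨R, -, hR⟩ := exists_radius_of_hasCompactSupport hf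
  obtain ⟨N, hN⟩ := exists_card_lattice_near_le n R
  refine ⟨Fintype.card ι * N, fun x => ?_⟩
  obtain ⟨T, hT, hTR⟩ := hN x
  refine ⟨Finset.univ ×ˢ T, ?_, fun q hq => hR _ _ (hTR _ fun h => hq ?_)⟩
  · rw [Finset.card_product]
    exact Nat.mul_le_mul_left _ hT
  · exact Finset.mem_product.2 ⟨Finset.mem_univ _, h⟩

/-- Superpositions of the translates with coefficients of modulus one are bounded, uniformly in
the coefficients. -/
theorem exists_enorm_tsum_le [Finite ι] {f g : ι → E n → 𝕜}
    (hf : ∀ ε, HasCompactSupport (f ε)) {M : ℝ} (hM : ∀ ε x, ‖g ε x‖ ≤ M)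
    (hg : ∀ ε x, x ∉ tsupport (f ε) → g ε x = 0) :
    ∃ C : ℝ≥0, ∀ (η : ι × (Fin n → ℤ) → 𝕜), (∀ q, ‖η q‖ = 1) → ∀ x : E n,
      ‖∑' q, η q * g q.1 (x - latticePt q.2)‖ₑ ≤ C := by
  obtain ⟨N, hN⟩ := exists_finset_forall_notMem_eq_zero hf
  refine ⟨N * M.toNNReal, fun η hη x => ?_⟩
  obtain ⟨T, hT, hTx⟩ := hN x
  rw [tsum_eq_sum (s := T) fun q hq => by rw [hg _ _ (hTx q hq), mul_zero]]
  rw [← ofReal_norm]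
  have h1 : ‖∑ q ∈ T, η q * g q.1 (x - latticePt q.2)‖ ≤ T.card * M.toNNReal := by
    refine (norm_sum_le_of_le T (f := fun q => η q * g q.1 (x - latticePt q.2))
      (n := fun _ => (M.toNNReal : ℝ)) fun q _ => ?_).trans ?_
    · rw [norm_mul, hη, one_mul]
      exact (hM _ _).trans (Real.le_coe_toNNReal M)
    · simp
  have h2 : (T.card : ℝ) * M.toNNReal ≤ ((N * M.toNNReal : ℝ≥0) : ℝ) := by
    push_cast
    gcongr
  rw [← ENNReal.ofReal_coe_nnreal]
  exact ENNReal.ofReal_le_ofReal (h1.trans h2)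

theorem supSum_lt_top [Finite ι] {ψ : ι → E n → 𝕜} (hψ : ∀ ε, HasCompactSupport (ψ ε))
    (hc : ∀ ε, Continuous (ψ ε)) : supSum ψ < ⊤ := by
  obtain ⟨M, -, hM⟩ := exists_forall_norm_le_of_hasCompactSupport hψ hc
  obtain ⟨C, hC⟩ := exists_enorm_tsum_le hψ hM fun ε x hx => image_eq_zero_of_notMem_tsupport hx
  refine lt_of_le_of_lt (iSup₂_le fun η hη => iSup_le fun x => ?_) (ENNReal.coe_lt_top (r := C))
  simp_rw [atom_zero]
  exact hC η hη x

theorem fderiv_atom_zero (f : E n → 𝕜) (k : Fin n → ℤ) (x : E n) :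
    fderiv ℝ (atom f 0 k) x = fderiv ℝ f (x - latticePt k) := by
  have : atom f 0 k = fun x => f (x - latticePt k) := funext (atom_zero f k)
  rw [this, fderiv_comp_sub]

theorem fderiv_eq_zero_of_notMem_tsupport {f : E n → 𝕜} {x : E n} (hx : x ∉ tsupport f) :
    fderiv ℝ f x = 0 := by
  by_contra h
  exact hx (support_fderiv_subset ℝ h)

theorem supSumDeriv_lt_top [Finite ι] {ψ : ι → E n → 𝕜} (hψ : ∀ ε, HasCompactSupport (ψ ε))
    (hc : ∀ ε, ContDiff ℝ 1 (ψ ε)) (i : Fin n) : supSumDeriv ψ i < ⊤ := by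
  obtain ⟨M, hM0, hM⟩ := exists_forall_norm_le_of_hasCompactSupport
    (fun ε => (hψ ε).fderiv (𝕜 := ℝ)) (fun ε => (hc ε).continuous_fderiv (by simp))
  obtain ⟨C, hC⟩ := exists_enorm_tsum_le (f := ψ) (M := M)
    (g := fun ε x => fderiv ℝ (ψ ε) x (EuclideanSpace.single i 1)) hψ
    (fun ε x => by
      refine (ContinuousLinearMap.le_opNorm _ _).trans ?_
      rw [PiLp.norm_single, norm_one, mul_one]
      exact hM ε x)
    (fun ε x hx => by
      rw [fderiv_eq_zero_of_notMem_tsupport hx, zero_apply])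
  refine lt_of_le_of_lt (iSup₂_le fun η hη => iSup_le fun x => ?_) (ENNReal.coe_lt_top (r := C))
  simp_rw [fderiv_atom_zero]
  exact hC η hη x

theorem exists_holder_of_contDiff {f : E n → 𝕜} (hf : HasCompactSupport f) (hc : ContDiff ℝ 1 f)
    {s : ℝ} (hs0 : 0 < s) (hs1 : s ≤ 1) :
    ∃ C : ℝ≥0, 0 < C ∧ ∀ x y, ‖f x - f y‖ ≤ C * ‖x - y‖ ^ s := by
  obtain ⟨L, hL⟩ := hc.lipschitzWith_of_hasCompactSupport hf (by simp)
  obtain ⟨M, hM⟩ := hc.continuous.bounded_above_of_compact_support hf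
  have hM0 : 0 ≤ M := (norm_nonneg _).trans (hM 0)
  refine ⟨L + 2 * M.toNNReal + 1, by positivity, fun x y => ?_⟩
  have h1 : ‖f x - f y‖ ≤ L * ‖x - y‖ := by simpa [dist_eq_norm] using hL.dist_le_mul x y
  have h2 : ‖f x - f y‖ ≤ 2 * M := (norm_sub_le _ _).trans (by linarith [hM x, hM y])
  push_cast
  rw [Real.coe_toNNReal M hM0]
  have hL0 : (0 : ℝ) ≤ L := L.2
  rcases le_total ‖x - y‖ 1 with hd | hd
  · have h3 : ‖x - y‖ ≤ ‖x - y‖ ^ s := by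
      simpa using Real.rpow_le_rpow_of_exponent_ge' (norm_nonneg (x - y)) hd hs0.le hs1
    have h4 : 0 ≤ ‖x - y‖ ^ s := by positivity
    nlinarith [mul_le_mul_of_nonneg_left h3 hL0]
  · have h3 : 1 ≤ ‖x - y‖ ^ s := Real.one_le_rpow hd hs0.le
    nlinarith

/-- Only boundedly many translates contribute to an increment, and each is `s`-Hölder. -/
theorem a21_lt_top {φ : E n → 𝕜} (hφ : HasCompactSupport φ) (hc : ContDiff ℝ 1 φ)
    {s : ℝ} (hs0 : 0 < s) (hs1 : s ≤ 1) : a21 φ s < ⊤ := by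
  obtain ⟨C, hC0, hC⟩ := exists_holder_of_contDiff hφ hc hs0 hs1
  obtain ⟨N, hN⟩ := exists_finset_forall_notMem_eq_zero (ι := Unit) (f := fun _ => φ) fun _ => hφ
  refine lt_of_le_of_lt (iSup₂_le fun η hη => iSup_le fun x => iSup_le fun y => iSup_le fun hxy => ?_)
    (ENNReal.coe_lt_top (r := (2 * N : ℝ≥0) * C))
  classical
  obtain ⟨T, hT, hTx⟩ := hN x
  obtain ⟨T', hT', hTy⟩ := hN y
  have hz : ∀ k ∉ (T ∪ T').image Prod.snd, atom φ 0 k x = 0 ∧ atom φ 0 k y = 0 := by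
    intro k hk
    have hk' : ((), k) ∉ T ∪ T' := fun h => hk (Finset.mem_image.2 ⟨_, h, rfl⟩)
    rw [Finset.mem_union, not_or] at hk'
    rw [atom_zero, atom_zero]
    exact ⟨image_eq_zero_of_notMem_tsupport (hTx _ hk'.1),
      image_eq_zero_of_notMem_tsupport (hTy _ hk'.2)⟩
  have hcard : ((T ∪ T').image Prod.snd).card ≤ 2 * N :=
    Finset.card_image_le.trans ((Finset.card_union_le _ _).trans (by omega))
  rw [tsum_eq_sum (s := (T ∪ T').image Prod.snd) fun q hq => by rw [(hz q hq).1, mul_zero],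
    tsum_eq_sum (s := (T ∪ T').image Prod.snd) fun q hq => by rw [(hz q hq).2, mul_zero],
    ← Finset.sum_sub_distrib]
  refine ENNReal.div_le_of_le_mul ?_
  rw [← ofReal_norm, edist_dist, dist_eq_norm,
    ENNReal.ofReal_rpow_of_nonneg (norm_nonneg _) hs0.le, ← ENNReal.ofReal_coe_nnreal,
    ← ENNReal.ofReal_mul (by positivity)]
  refine ENNReal.ofReal_le_ofReal ?_
  refine (norm_sum_le_of_le _ (n := fun _ => C * ‖x - y‖ ^ s) fun q _ => ?_).trans ?_
  · rw [← mul_sub, norm_mul, hη, one_mul, atom_zero, atom_zero]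
    refine (hC _ _).trans_eq ?_
    congr 3
    abel
  · rw [Finset.sum_const, nsmul_eq_mul, ← mul_assoc]
    have : (((T ∪ T').image Prod.snd).card : ℝ) ≤ 2 * N := by exact_mod_cast hcard
    push_cast
    gcongr

/-- Since `∫ g = 0`, the function `f` may be replaced by `f - f 0`, which is at most `‖x‖ ^ s`. -/
theorem holderDualNorm_lt_top {g : E n → 𝕜} (hg : HasCompactSupport g) (hc : Continuous g)
    (hint : ∫ x, g x = 0) {s : ℝ} (hs0 : 0 < s) : holderDualNorm s g < ⊤ := by
  have hi : Integrable (fun x => ‖x‖ ^ s * ‖g x‖) :=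
    Continuous.integrable_of_hasCompactSupport
      ((continuous_norm.rpow_const fun _ => Or.inr hs0.le).mul hc.norm) (hg.norm.mul_left)
  refine lt_of_le_of_lt (iSup₂_le fun f hf => ?_)
    (ENNReal.ofReal_lt_top (r := ∫ x, ‖x‖ ^ s * ‖g x‖))
  have hfc : Continuous f :=
    continuous_of_abs_sub_le_dist_rpow hs0 (by simpa only [dist_eq_norm] using hf)
  have e : ∫ x, f x * g x = ∫ x, (f x - f 0) * g x := by
    have h1 : Integrable fun x => f x * g x :=
      (hfc.mul hc).integrable_of_hasCompactSupport hg.mul_left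
    have h2 : Integrable fun x => f 0 * g x :=
      (hc.integrable_of_hasCompactSupport hg).const_mul _
    simp_rw [sub_mul]
    rw [integral_sub h1 h2, integral_const_mul, hint, mul_zero, sub_zero]
  rw [e, ← ofReal_norm]
  refine ENNReal.ofReal_le_ofReal (norm_integral_le_of_norm_le hi (Filter.Eventually.of_forall fun x => ?_))
  rw [norm_mul]
  gcongr
  simpa using hf x 0

/-- The test function is a multiple of the conjugate of `g`. -/
theorem holderDualNorm_pos {g : E n → 𝕜} (hg : HasCompactSupport g) (hc : ContDiff ℝ 1 g)
    {x₀ : E n} (hx₀ : g x₀ ≠ 0) {s : ℝ} (hs0 : 0 < s) (hs1 : s ≤ 1) : 0 < holderDualNorm s g := by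
  obtain ⟨C, hC0, hC⟩ := exists_holder_of_contDiff hg hc hs0 hs1
  let f : E n → 𝕜 := fun x => ((C⁻¹ : ℝ) : 𝕜) * (starRingEnd 𝕜) (g x)
  have hCr : (0 : ℝ) < C := hC0
  have hf : ∀ x y, ‖f x - f y‖ ≤ ‖x - y‖ ^ s := fun x y => by
    simp only [f]
    rw [← mul_sub, ← map_sub, norm_mul, RCLike.norm_conj, RCLike.norm_ofReal,
      abs_of_pos (inv_pos.2 hCr), inv_mul_le_iff₀ hCr]
    exact hC x y
  refine lt_of_lt_of_le ?_ (le_iSup₂ (f := fun (f : E n → 𝕜)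
    (_ : ∀ x y, ‖f x - f y‖ ≤ ‖x - y‖ ^ s) => ‖∫ x, f x * g x‖ₑ) f hf)
  rw [enorm_pos]
  have e : ∀ x, f x * g x = ((C⁻¹ * ‖g x‖ ^ 2 : ℝ) : 𝕜) := fun x => by
    simp only [f]
    rw [mul_assoc, RCLike.conj_mul]
    push_cast
    rfl
  simp_rw [e]
  rw [integral_ofReal, RCLike.ofReal_ne_zero, integral_const_mul]
  refine mul_ne_zero (inv_ne_zero hCr.ne') (ne_of_gt ?_)
  refine Continuous.integral_pos_of_hasCompactSupport_nonneg_nonzero (x := x₀)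
    (hc.continuous.norm.pow 2) ?_ (fun x => by positivity) (by positivity)
  exact hg.comp_left (g := fun z => ‖z‖ ^ 2) (by simp)

/-- A scalar of modulus one that rotates `z` onto the positive half-axis. -/
theorem exists_norm_one_mul_eq_norm (z : 𝕜) : ∃ u : 𝕜, ‖u‖ = 1 ∧ u * z = (‖z‖ : 𝕜) := by
  by_cases hz : z = 0
  · exact ⟨1, norm_one, by simp [hz]⟩
  · have hz' : ‖z‖ ≠ 0 := norm_ne_zero_iff.2 hz
    refine ⟨(‖z‖ : 𝕜)⁻¹ * (starRingEnd 𝕜) z, ?_, ?_⟩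
    · rw [norm_mul, norm_inv, RCLike.norm_conj, RCLike.norm_ofReal, abs_norm,
        inv_mul_cancel₀ hz']
    · rw [mul_assoc, RCLike.conj_mul, sq, inv_mul_cancel_left₀ (by exact_mod_cast hz')]

/-- Aligning all terms at a point where some `ψ ε₀` does not vanish gives a nonzero sum. -/
theorem supSum_pos {ψ : ι → E n → 𝕜} [Finite ι] (hψ : ∀ ε, HasCompactSupport (ψ ε))
    {ε₀ : ι} {x₀ : E n} (hx₀ : ψ ε₀ x₀ ≠ 0) : 0 < supSum ψ := by
  obtain ⟨N, hN⟩ := exists_finset_forall_notMem_eq_zero hψ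
  obtain ⟨T, -, hT⟩ := hN x₀
  have hT0 : ∀ q ∉ T, atom (ψ q.1) 0 q.2 x₀ = 0 := fun q hq => by
    rw [atom_zero]; exact image_eq_zero_of_notMem_tsupport (hT q hq)
  choose u hu1 hu using exists_norm_one_mul_eq_norm (𝕜 := 𝕜)
  refine lt_of_lt_of_le ?_ ((le_iSup (fun x : E n => ‖∑' q : ι × (Fin n → ℤ),
      u (atom (ψ q.1) 0 q.2 x₀) * atom (ψ q.1) 0 q.2 x‖ₑ) x₀).trans
    (le_iSup₂ (f := fun (η : ι × (Fin n → ℤ) → 𝕜) (_ : ∀ q, ‖η q‖ = 1) => ⨆ x : E n,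
      ‖∑' q : ι × (Fin n → ℤ), η q * atom (ψ q.1) 0 q.2 x‖ₑ)
      (fun q => u (atom (ψ q.1) 0 q.2 x₀)) fun q => hu1 _))
  rw [enorm_pos, tsum_eq_sum (s := T) fun q hq => by rw [hT0 q hq, mul_zero]]
  simp_rw [hu]
  rw [← RCLike.ofReal_sum, RCLike.ofReal_ne_zero]
  have hmem : (ε₀, (0 : Fin n → ℤ)) ∈ T := by
    by_contra h
    have := hT0 _ h
    rw [atom_zero] at this
    refine hx₀ ?_
    simpa [latticePt_zero] using this
  refine ne_of_gt (lt_of_lt_of_le (norm_pos_iff.2 hx₀) ?_)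
  have := Finset.single_le_sum (f := fun q : ι × (Fin n → ℤ) => ‖atom (ψ q.1) 0 q.2 x₀‖)
    (fun _ _ => norm_nonneg _) hmem
  simpa [atom_zero, latticePt_zero] using this

end

/-! ### Sums over levels, and signed sums of coefficients -/

/-- The sum over all levels `j` of `2 ^ (-js) min (2S, S' 2 ^ j d)` is at most a constant times `d ^ s`. -/
theorem tsum_ofReal_dyadic_le {s : ℝ} (hs0 : 0 < s) (hs1 : s < 1) {S S' d : ℝ} (hS : 0 ≤ S)
    (hS' : 0 ≤ S') (hd : 0 ≤ d) {a : ℕ → ℝ}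
    (h1 : ∀ j, a j ≤ ((2 : ℝ) ^ (-s)) ^ j * (2 * S))
    (h2 : ∀ j, a j ≤ ((2 : ℝ) ^ (1 - s)) ^ j * (S' * d)) :
    ∑' j, ENNReal.ofReal (a j) ≤ ENNReal.ofReal
      (((2 : ℝ) ^ (1 - s) / ((2 : ℝ) ^ (1 - s) - 1) * S' + 2 / (1 - (2 : ℝ) ^ (-s)) * S) * d ^ s) := by
  rcases hd.eq_or_lt with rfl | hd
  · have : ∀ j, ENNReal.ofReal (a j) = 0 := fun j => by
      rw [ENNReal.ofReal_eq_zero]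
      simpa using h2 j
    simp [this]
  set ρ := (2 : ℝ) ^ (1 - s) with hρ
  set τ := (2 : ℝ) ^ (-s) with hτ
  have hρ1 : 1 < ρ := Real.one_lt_rpow (by norm_num) (by linarith)
  have hτ0 : 0 < τ := by positivity
  have hτ1 : τ < 1 := Real.rpow_lt_one_of_one_lt_of_neg (by norm_num) (by linarith)
  have hρpow : ∀ j : ℕ, ρ ^ j = ((2 : ℝ) ^ j) ^ (1 - s) := fun j => by
    rw [hρ, ← Real.rpow_natCast, ← Real.rpow_mul (by norm_num), mul_comm,
      Real.rpow_mul (by norm_num), Real.rpow_natCast]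
  have hτpow : ∀ j : ℕ, τ ^ j = ((2 : ℝ) ^ j) ^ (-s) := fun j => by
    rw [hτ, ← Real.rpow_natCast, ← Real.rpow_mul (by norm_num), mul_comm,
      Real.rpow_mul (by norm_num), Real.rpow_natCast]
  have hex : ∃ j : ℕ, 1 < 2 ^ j * d := by
    obtain ⟨j, hj⟩ := pow_unbounded_of_one_lt d⁻¹ (by norm_num : (1 : ℝ) < 2)
    exact ⟨j, by rwa [inv_lt_iff_one_lt_mul₀ hd] at hj⟩
  classical
  -- Below `J`, the first level with `2 ^ J d > 1`, the terms grow like `ρ ^ j` and are bounded by `h2`;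
  -- from `J` on they decay like `τ ^ j` and are bounded by `h1`.
  let J := Nat.find hex
  have hJ : 1 < 2 ^ J * d := Nat.find_spec hex
  have hsmall : ∑ j ∈ Finset.range J, ρ ^ j * (S' * d) ≤ ρ / (ρ - 1) * S' * d ^ s := by
    rw [← Finset.sum_mul, geom_sum_eq hρ1.ne']
    have key : (ρ ^ J - 1) * d ≤ ρ * d ^ s := by
      by_cases hJ0 : J = 0
      · rw [hJ0]; simp; positivity
      · obtain ⟨m, hm⟩ := Nat.exists_eq_succ_of_ne_zero hJ0
        have hm1 : 2 ^ m * d ≤ 1 := not_lt.1 (Nat.find_min hex (by omega : m < J))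
        have h3 : ρ ^ m * d ^ (1 - s) ≤ 1 := by
          rw [hρpow, ← Real.mul_rpow (by positivity) hd.le]
          exact Real.rpow_le_one (by positivity) hm1 (by linarith)
        have h4 : d = d ^ (1 - s) * d ^ s := by
          rw [← Real.rpow_add hd]; simp
        have hds : 0 < d ^ s := by positivity
        calc (ρ ^ J - 1) * d ≤ ρ ^ J * d := by nlinarith
          _ = ρ * (ρ ^ m * d ^ (1 - s)) * d ^ s := by
            conv_lhs => rw [h4, hm]
            rw [pow_succ]; ring
          _ ≤ ρ * 1 * d ^ s := by gcongr
          _ = ρ * d ^ s := by ring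
    have hρ' : 0 < ρ - 1 := by linarith
    calc (ρ ^ J - 1) / (ρ - 1) * (S' * d) = ((ρ ^ J - 1) * d) * S' / (ρ - 1) := by ring
      _ ≤ (ρ * d ^ s) * S' / (ρ - 1) := by gcongr
      _ = _ := by ring
  have hlarge : ∀ m, ∑ i ∈ Finset.range m, τ ^ (J + i) * (2 * S) ≤ 2 / (1 - τ) * S * d ^ s := by
    intro m
    simp_rw [pow_add]
    rw [← Finset.sum_mul, ← Finset.mul_sum]
    have hτ' : 0 < 1 - τ := by linarith
    have h3 : τ ^ J ≤ d ^ s := by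
      rw [hτpow, Real.rpow_neg (by positivity), inv_le_iff_one_le_mul₀ (by positivity),
        ← Real.mul_rpow hd.le (by positivity), mul_comm]
      exact Real.one_le_rpow hJ.le hs0.le
    have h4 : ∑ i ∈ Finset.range m, τ ^ i ≤ 1 / (1 - τ) := by
      rw [geom_sum_eq hτ1.ne, ← neg_div_neg_eq, neg_sub, neg_sub]
      gcongr
      linarith [pow_pos hτ0 m]
    calc τ ^ J * (∑ i ∈ Finset.range m, τ ^ i) * (2 * S)
        ≤ d ^ s * (1 / (1 - τ)) * (2 * S) := by gcongr
      _ = _ := by ring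
  rw [ENNReal.tsum_eq_iSup_nat]
  refine iSup_le fun m => ?_
  refine (Finset.sum_le_sum_of_subset (Finset.range_mono (Nat.le_add_left m J))).trans ?_
  have hnn : ∀ j, 0 ≤ max (a j) 0 := fun j => le_max_right _ _
  have e : ∀ j, ENNReal.ofReal (a j) = ENNReal.ofReal (max (a j) 0) := fun j => by
    rw [ENNReal.ofReal_max]; simp
  simp_rw [e]
  rw [← ENNReal.ofReal_sum_of_nonneg fun j _ => hnn j]
  refine ENNReal.ofReal_le_ofReal ?_
  rw [Finset.sum_range_add, add_mul]
  refine add_le_add ((Finset.sum_le_sum fun j _ => ?_).trans hsmall)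
    ((Finset.sum_le_sum fun j _ => ?_).trans (hlarge m))
  · exact max_le (h2 j) (by positivity)
  · exact max_le (h1 _) (by positivity)

section
variable {𝕜 : Type*} [RCLike 𝕜] {n : ℕ} {ι : Type*}

/-- Points of a bounded set, dilated by `c`, are within distance `R` of finitely many lattice points. -/
theorem exists_finset_lattice_near {K : Set (E n)} (hK : Bornology.IsBounded K) (c R : ℝ) :
    ∃ T : Finset (Fin n → ℤ), ∀ k ∉ T, ∀ x ∈ K, R < ‖c • x - latticePt k‖ := by
  obtain ⟨M, hM⟩ := hK.exists_norm_le
  refine ⟨(finite_norm_latticePt_le (|c| * M + R)).toFinset, fun k hk x hx => ?_⟩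
  rw [Set.Finite.mem_toFinset, Set.mem_ofPred_eq, not_le] at hk
  have h1 : ‖(latticePt k : E n)‖ ≤ ‖c • x‖ + ‖c • x - latticePt k‖ := by
    simpa using norm_sub_le (c • x) (c • x - latticePt k)
  have h2 : ‖c • x‖ ≤ |c| * M := by
    rw [norm_smul, Real.norm_eq_abs]
    exact mul_le_mul_of_nonneg_left (hM x hx) (abs_nonneg _)
  linarith

theorem exists_finset_atom_eq_zero [Finite ι] {ψ : ι → E n → 𝕜}
    (hψ : ∀ ε, HasCompactSupport (ψ ε)) {K : Set (E n)} (hK : Bornology.IsBounded K) (j : ℤ) :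
    ∃ T : Finset (ι × (Fin n → ℤ)), ∀ q ∉ T, ∀ x ∈ K, atom (ψ q.1) j q.2 x = 0 := by
  cases nonempty_fintype ι
  obtain ⟨R, -, hR⟩ := exists_radius_of_hasCompactSupport hψ
  obtain ⟨T, hT⟩ := exists_finset_lattice_near hK ((2 : ℝ) ^ j) R
  refine ⟨Finset.univ ×ˢ T, fun q hq x hx => ?_⟩
  rw [atom, image_eq_zero_of_notMem_tsupport (hR q.1 _ (hT q.2 (fun h => hq ?_) x hx)), smul_zero]
  exact Finset.mem_product.2 ⟨Finset.mem_univ _, h⟩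

theorem continuous_atom {f : E n → 𝕜} (hf : Continuous f) (j : ℤ) (k : Fin n → ℤ) :
    Continuous (atom f j k) := by
  unfold atom
  fun_prop

theorem hasCompactSupport_atom {f : E n → 𝕜} (hf : HasCompactSupport f) (j : ℤ) (k : Fin n → ℤ) :
    HasCompactSupport (atom f j k) := by
  have h2 : (2 : ℝ) ^ j ≠ 0 := by positivity
  have h1 : HasCompactSupport fun x => f (((2 : ℝ) ^ j) • x - latticePt k) :=
    hf.comp_homeomorph ((Homeomorph.smulOfNeZero _ h2).trans (Homeomorph.subRight (latticePt k)))
  exact h1.smul_left (f := fun _ => (2 : ℝ) ^ ((n : ℝ) * (j : ℝ) / 2))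

theorem integral_density_mul {K : Set (E n)} {μ : Measure (E n)} (hμ : IsProbAb2 K μ)
    (h : E n → 𝕜) : ∫ x, (density μ x : 𝕜) * h x = ∫ x, h x ∂μ := by
  have := hμ.isProbabilityMeasure
  rw [← integral_rnDeriv_smul hμ.absolutelyContinuous]
  simp only [density, RCLike.real_smul_eq_coe_mul]

theorem integrable_density_mul {K : Set (E n)} {μ : Measure (E n)} (hμ : IsProbAb2 K μ)
    {h : E n → 𝕜} (hh : Integrable h μ) : Integrable fun x => (density μ x : 𝕜) * h x := by
  have := hμ.isProbabilityMeasure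
  have := (integrable_rnDeriv_smul_iff hμ.absolutelyContinuous).2 hh
  simpa only [density, RCLike.real_smul_eq_coe_mul] using this

theorem integral_density_sub_mul {K : Set (E n)} {μ ν : Measure (E n)} (hμ : IsProbAb2 K μ)
    (hν : IsProbAb2 K ν) {h : E n → 𝕜} (h1 : Integrable h μ) (h2 : Integrable h ν) :
    ∫ x, ((density μ x - density ν x : ℝ) : 𝕜) * h x = ∫ x, h x ∂μ - ∫ x, h x ∂ν := by
  rw [← integral_density_mul hμ, ← integral_density_mul hν,
    ← integral_sub (integrable_density_mul hμ h1) (integrable_density_mul hν h2)]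
  simp_rw [RCLike.ofReal_sub, sub_mul]

theorem integrable_conj_atom {f : E n → 𝕜} (hf : HasCompactSupport f) (hc : Continuous f)
    (j : ℤ) (k : Fin n → ℤ) (μ : Measure (E n)) [IsFiniteMeasure μ] :
    Integrable (fun x => (starRingEnd 𝕜) (atom f j k x)) μ :=
  Continuous.integrable_of_hasCompactSupport (RCLike.continuous_conj.comp (continuous_atom hc j k))
    ((hasCompactSupport_atom hf j k).comp_left (map_zero _))

theorem coeff_eq {K : Set (E n)} {μ ν : Measure (E n)} (hμ : IsProbAb2 K μ)
    (hν : IsProbAb2 K ν) {f : E n → 𝕜} (hf : HasCompactSupport f) (hc : Continuous f)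
    (j : ℤ) (k : Fin n → ℤ) :
    coeff μ ν f j k = ∫ x, (starRingEnd 𝕜) (atom f j k x) ∂μ -
      ∫ x, (starRingEnd 𝕜) (atom f j k x) ∂ν := by
  have := hμ.isProbabilityMeasure
  have := hν.isProbabilityMeasure
  exact integral_density_sub_mul hμ hν (integrable_conj_atom hf hc j k μ)
    (integrable_conj_atom hf hc j k ν)

theorem integral_eq_zero_of_eqOn_zero {K : Set (E n)} {μ : Measure (E n)} (hμ : μ Kᶜ = 0)
    {h : E n → 𝕜} (hh : ∀ x ∈ K, h x = 0) : ∫ x, h x ∂μ = 0 := by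
  rw [← integral_zero (E n) 𝕜 (μ := μ)]
  refine integral_congr_ae ?_
  have : ∀ᵐ x ∂μ, x ∈ K := by rwa [ae_iff]
  filter_upwards [this] with x hx using hh x hx

/-- For a suitable choice of signs, the sum of the moduli of the differences of the integrals is
bounded by the transport cost of the signed superposition. -/
theorem exists_signs_tsum_enorm_le {Q : Type*} {K : Set (E n)} {μ ν : Measure (E n)}
    [IsProbabilityMeasure μ] (hμ : μ Kᶜ = 0) (hν : ν Kᶜ = 0)
    {γ : Measure (E n × E n)} (hγ1 : γ.map Prod.fst = μ) (hγ2 : γ.map Prod.snd = ν)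
    {e : Q → E n → 𝕜} (hc : ∀ q, Continuous (e q)) (hs : ∀ q, HasCompactSupport (e q))
    (T : Finset Q) (hT : ∀ q ∉ T, ∀ x ∈ K, e q x = 0) :
    ∃ η : Q → 𝕜, (∀ q, ‖η q‖ = 1) ∧
      ∑' q, ‖∫ x, (starRingEnd 𝕜) (e q x) ∂μ - ∫ x, (starRingEnd 𝕜) (e q x) ∂ν‖ₑ ≤
        ∫⁻ z, ‖(∑' q, η q * e q z.1) - ∑' q, η q * e q z.2‖ₑ ∂γ := by
  have : IsProbabilityMeasure (γ.map Prod.fst) := by rw [hγ1]; infer_instance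
  have hγp : IsProbabilityMeasure γ := Measure.isProbabilityMeasure_of_map Prod.fst
  set c : Q → 𝕜 := fun q =>
    ∫ x, (starRingEnd 𝕜) (e q x) ∂μ - ∫ x, (starRingEnd 𝕜) (e q x) ∂ν
  -- `u q` rotates the difference `c q` onto its modulus, so the sum of the moduli is one integral.
  choose u hu1 hu using fun q => exists_norm_one_mul_eq_norm (c q)
  refine ⟨fun q => (starRingEnd 𝕜) (u q), fun q => by rw [RCLike.norm_conj, hu1], ?_⟩
  have hcont : ∀ q, Continuous fun x => (starRingEnd 𝕜) (e q x) := fun q =>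
    RCLike.continuous_conj.comp (hc q)
  have hi : ∀ q, ∀ p : E n × E n → E n, Continuous p →
      Integrable (fun z => (starRingEnd 𝕜) (e q (p z))) γ := fun q p hp => by
    obtain ⟨M, hM⟩ := (hc q).bounded_above_of_compact_support (hs q)
    refine Integrable.of_bound ((hcont q).comp hp).aestronglyMeasurable M
      (Filter.Eventually.of_forall fun z => ?_)
    simpa using hM (p z)
  have hc0 : ∀ q ∉ T, c q = 0 := fun q hq => by
    simp only [c]
    rw [integral_eq_zero_of_eqOn_zero hμ fun x hx => by rw [hT q hq x hx, map_zero],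
      integral_eq_zero_of_eqOn_zero hν fun x hx => by rw [hT q hq x hx, map_zero], sub_zero]
  have hcγ : ∀ q, c q = ∫ z, ((starRingEnd 𝕜) (e q z.1) - (starRingEnd 𝕜) (e q z.2)) ∂γ := by
    intro q
    rw [integral_sub (hi q _ continuous_fst) (hi q _ continuous_snd)]
    simp only [c]
    rw [← hγ1, ← hγ2, integral_map measurable_fst.aemeasurable (hcont q).aestronglyMeasurable,
      integral_map measurable_snd.aemeasurable (hcont q).aestronglyMeasurable]
  change ∑' q, ‖c q‖ₑ ≤ _
  rw [tsum_eq_sum (s := T) fun q hq => by rw [hc0 q hq, enorm_zero]]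
  have h1 : ∑ q ∈ T, ‖c q‖ₑ = ‖∑ q ∈ T, u q * c q‖ₑ := by
    simp_rw [hu]
    rw [← RCLike.ofReal_sum, ← ofReal_norm, RCLike.norm_ofReal,
      abs_of_nonneg (Finset.sum_nonneg fun _ _ => norm_nonneg _),
      ENNReal.ofReal_sum_of_nonneg fun _ _ => norm_nonneg _]
    simp_rw [ofReal_norm]
  have h2 : ∑ q ∈ T, u q * c q = ∫ z, ∑ q ∈ T,
      u q * ((starRingEnd 𝕜) (e q z.1) - (starRingEnd 𝕜) (e q z.2)) ∂γ := by
    have hsub : ∀ q, Integrable (fun z : E n × E n =>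
        (starRingEnd 𝕜) (e q z.1) - (starRingEnd 𝕜) (e q z.2)) γ := fun q =>
      (hi q _ continuous_fst).sub (hi q _ continuous_snd)
    rw [integral_finsetSum _ fun q _ => (hsub q).const_mul _]
    simp_rw [hcγ, integral_const_mul]
  refine h1.trans_le ?_
  rw [h2]
  refine (enorm_integral_le_lintegral_enorm _).trans (lintegral_mono_ae ?_)
  have hK1 : ∀ᵐ z ∂γ, z.1 ∈ K := by
    have : ∀ᵐ x ∂(γ.map Prod.fst), x ∈ K := by rw [hγ1]; rwa [ae_iff]
    exact ae_of_ae_map measurable_fst.aemeasurable this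
  have hK2 : ∀ᵐ z ∂γ, z.2 ∈ K := by
    have : ∀ᵐ x ∂(γ.map Prod.snd), x ∈ K := by rw [hγ2]; rwa [ae_iff]
    exact ae_of_ae_map measurable_snd.aemeasurable this
  filter_upwards [hK1, hK2] with z hz1 hz2
  rw [tsum_eq_sum (s := T) fun q hq => by rw [hT q hq _ hz1, mul_zero],
    tsum_eq_sum (s := T) fun q hq => by rw [hT q hq _ hz2, mul_zero], ← Finset.sum_sub_distrib,
    ← ofReal_norm, ← ofReal_norm]
  refine ENNReal.ofReal_le_ofReal (le_of_eq ?_)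
  rw [← RCLike.norm_conj, map_sum]
  congr 1
  refine Finset.sum_congr rfl fun q _ => ?_
  simp only [map_mul, map_sub, RCLike.conj_conj, mul_sub]

end

/-! ### The upper bound -/

section
variable {𝕜 : Type*} [RCLike 𝕜] {n : ℕ} {ι : Type*}

/-- The superposition `∑ η_{ε,k} ψ_ε(x - k)` of the integer translates of the `ψ_ε`. -/
noncomputable def signedSum (ψ : ι → E n → 𝕜) (η : ι × (Fin n → ℤ) → 𝕜) (x : E n) : 𝕜 :=
  ∑' q : ι × (Fin n → ℤ), η q * atom (ψ q.1) 0 q.2 x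

theorem tsum_mul_atom (ψ : ι → E n → 𝕜) (η : ι × (Fin n → ℤ) → 𝕜) (j : ℤ) (x : E n) :
    ∑' q : ι × (Fin n → ℤ), η q * atom (ψ q.1) j q.2 x =
      ((2 : ℝ) ^ ((n : ℝ) * (j : ℝ) / 2)) • signedSum ψ η (((2 : ℝ) ^ j) • x) := by
  simp_rw [atom_eq _ j, RCLike.real_smul_eq_coe_mul]
  rw [signedSum, ← tsum_mul_left]
  congr 1
  ext q
  ring

theorem norm_signedSum_le {ψ : ι → E n → 𝕜} (hfin : supSum ψ < ⊤)
    {η : ι × (Fin n → ℤ) → 𝕜} (hη : ∀ q, ‖η q‖ = 1) (x : E n) :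
    ‖signedSum ψ η x‖ ≤ (supSum ψ).toReal := by
  rw [← ENNReal.ofReal_le_ofReal_iff ENNReal.toReal_nonneg, ENNReal.ofReal_toReal hfin.ne,
    ofReal_norm]
  exact (le_iSup (fun x : E n => ‖signedSum ψ η x‖ₑ) x).trans
    (le_iSup₂ (f := fun (η : ι × (Fin n → ℤ) → 𝕜) (_ : ∀ q, ‖η q‖ = 1) => ⨆ x : E n,
      ‖signedSum ψ η x‖ₑ) η hη)

/-- In the Euclidean norm each coordinate of `v` is at most `‖v‖`. -/
theorem norm_clm_le_sum {F : Type*} [NormedAddCommGroup F] [NormedSpace ℝ F] (L : E n →L[ℝ] F)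
    {c : Fin n → ℝ} (hc : ∀ i, ‖L (EuclideanSpace.single i 1)‖ ≤ c i) : ‖L‖ ≤ ∑ i, c i := by
  have hc0 : ∀ i, 0 ≤ c i := fun i => (norm_nonneg _).trans (hc i)
  refine L.opNorm_le_bound (Finset.sum_nonneg fun i _ => hc0 i) fun v => ?_
  have hv : v = ∑ i, v i • EuclideanSpace.single i (1 : ℝ) := by
    conv_lhs => rw [← (EuclideanSpace.basisFun (Fin n) ℝ).sum_repr v]
    simp
  conv_lhs => rw [hv, map_sum]
  rw [Finset.sum_mul]
  refine norm_sum_le_of_le _ fun i _ => ?_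
  rw [map_smul, norm_smul, mul_comm]
  exact mul_le_mul (hc i) (PiLp.norm_apply_le v i) (norm_nonneg _) (hc0 i)

/-- The sum is locally finite, so it may be differentiated term by term. -/
theorem exists_hasFDerivAt_signedSum [Finite ι] {ψ : ι → E n → 𝕜}
    (hψ : ∀ ε, HasCompactSupport (ψ ε)) (hc : ∀ ε, ContDiff ℝ 1 (ψ ε))
    (η : ι × (Fin n → ℤ) → 𝕜) (x : E n) :
    ∃ L : E n →L[ℝ] 𝕜, HasFDerivAt (signedSum ψ η) L x ∧
      ∀ v, L v = ∑' q : ι × (Fin n → ℤ), η q * fderiv ℝ (atom (ψ q.1) 0 q.2) x v := by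
  obtain ⟨T, hT⟩ := exists_finset_atom_eq_zero hψ (Metric.isBounded_ball (x := x) (r := 1)) 0
  have hball : Metric.ball x 1 ∈ nhds x := Metric.ball_mem_nhds x one_pos
  have hdiff : ∀ q : ι × (Fin n → ℤ), DifferentiableAt ℝ (atom (ψ q.1) 0 q.2) x := fun q => by
    have : atom (ψ q.1) 0 q.2 = fun x => ψ q.1 (x - latticePt q.2) :=
      funext (atom_zero (ψ q.1) q.2)
    rw [this, differentiableAt_comp_sub]
    exact (hc q.1).differentiable (by simp) _
  have hG : signedSum ψ η =ᶠ[nhds x] fun y => ∑ q ∈ T, η q * atom (ψ q.1) 0 q.2 y := by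
    filter_upwards [hball] with y hy
    exact tsum_eq_sum fun q hq => by rw [hT q hq y hy, mul_zero]
  have hz : ∀ q ∉ T, fderiv ℝ (atom (ψ q.1) 0 q.2) x = 0 := fun q hq => by
    have : atom (ψ q.1) 0 q.2 =ᶠ[nhds x] fun _ => 0 := by
      filter_upwards [hball] with y hy using hT q hq y hy
    rw [this.fderiv_eq, fderiv_fun_const]
    rfl
  refine ⟨∑ q ∈ T, η q • fderiv ℝ (atom (ψ q.1) 0 q.2) x, ?_, fun v => ?_⟩
  · refine HasFDerivAt.congr_of_eventuallyEq ?_ hG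
    exact HasFDerivAt.fun_sum fun q _ => (hdiff q).hasFDerivAt.const_mul (η q)
  · rw [tsum_eq_sum (s := T) fun q hq => by
      rw [hz q hq, zero_apply, mul_zero]]
    simp

theorem norm_signedSum_sub_le [Finite ι] {ψ : ι → E n → 𝕜}
    (hψ : ∀ ε, HasCompactSupport (ψ ε)) (hc : ∀ ε, ContDiff ℝ 1 (ψ ε))
    {η : ι × (Fin n → ℤ) → 𝕜} (hη : ∀ q, ‖η q‖ = 1) (x y : E n) :
    ‖signedSum ψ η x - signedSum ψ η y‖ ≤ (∑ i, (supSumDeriv ψ i).toReal) * ‖x - y‖ := by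
  choose L hL hLv using exists_hasFDerivAt_signedSum hψ hc η
  refine convex_univ.norm_image_sub_le_of_norm_hasFDerivWithin_le
    (fun z _ => (hL z).hasFDerivWithinAt) (fun z _ => ?_) (Set.mem_univ y) (Set.mem_univ x)
  refine norm_clm_le_sum _ fun i => ?_
  rw [← ENNReal.ofReal_le_ofReal_iff ENNReal.toReal_nonneg,
    ENNReal.ofReal_toReal (supSumDeriv_lt_top hψ hc i).ne, ofReal_norm, hLv]
  exact (le_iSup (fun x : E n => ‖∑' q : ι × (Fin n → ℤ),
      η q * fderiv ℝ (atom (ψ q.1) 0 q.2) x (EuclideanSpace.single i 1)‖ₑ) z).trans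
    (le_iSup₂ (f := fun (η : ι × (Fin n → ℤ) → 𝕜) (_ : ∀ q, ‖η q‖ = 1) => ⨆ x : E n,
      ‖∑' q : ι × (Fin n → ℤ),
      η q * fderiv ℝ (atom (ψ q.1) 0 q.2) x (EuclideanSpace.single i 1)‖ₑ) η hη)

theorem two_rpow_ennreal_eq (t : ℝ) : (2 : ℝ≥0∞) ^ t = ENNReal.ofReal ((2 : ℝ) ^ t) := by
  rw [← ENNReal.ofReal_rpow_of_pos (by norm_num)]
  simp

theorem a22_eq_ofReal [Finite ι] {ψ : ι → E n → 𝕜}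
    (hψ : ∀ ε, HasCompactSupport (ψ ε)) (hc : ∀ ε, ContDiff ℝ 1 (ψ ε)) {s : ℝ} (hs0 : 0 < s)
    (hs1 : s < 1) :
    a22 ψ s = ENNReal.ofReal ((2 : ℝ) ^ (1 - s) / ((2 : ℝ) ^ (1 - s) - 1) *
      (∑ i, (supSumDeriv ψ i).toReal) + 2 / (1 - (2 : ℝ) ^ (-s)) * (supSum ψ).toReal) := by
  have h1 : 1 < (2 : ℝ) ^ (1 - s) := Real.one_lt_rpow (by norm_num) (by linarith)
  have h2 : (2 : ℝ) ^ (-s) < 1 := Real.rpow_lt_one_of_one_lt_of_neg (by norm_num) (by linarith)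
  have h3 : 0 ≤ (2 : ℝ) ^ (1 - s) / ((2 : ℝ) ^ (1 - s) - 1) := div_nonneg (by positivity) (by linarith)
  have h4 : 0 ≤ 2 / (1 - (2 : ℝ) ^ (-s)) := div_nonneg (by positivity) (by linarith)
  have h5 : 0 ≤ ∑ i, (supSumDeriv ψ i).toReal := Finset.sum_nonneg fun _ _ => ENNReal.toReal_nonneg
  rw [a22, ENNReal.ofReal_add (mul_nonneg h3 h5) (mul_nonneg h4 ENNReal.toReal_nonneg),
    ENNReal.ofReal_mul h3, ENNReal.ofReal_mul h4,
    ENNReal.ofReal_toReal (supSum_lt_top hψ fun ε => (hc ε).continuous).ne,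
    ENNReal.ofReal_sum_of_nonneg fun _ _ => ENNReal.toReal_nonneg]
  congr 2
  exact Finset.sum_congr rfl fun i _ =>
    (ENNReal.ofReal_toReal (supSumDeriv_lt_top hψ hc i).ne).symm

/-- The weighted sum over all levels of the increments of signed superpositions is `s`-Hölder with
constant `a22`. -/
theorem tsum_enorm_levels_le [Finite ι] {ψ : ι → E n → 𝕜}
    (hψ : ∀ ε, HasCompactSupport (ψ ε)) (hc : ∀ ε, ContDiff ℝ 1 (ψ ε)) {s : ℝ} (hs0 : 0 < s)
    (hs1 : s < 1) (η : ℕ → ι × (Fin n → ℤ) → 𝕜) (hη : ∀ j q, ‖η j q‖ = 1) (x y : E n) :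
    ∑' j : ℕ, (2 : ℝ≥0∞) ^ (-(j : ℝ) * (s + (n : ℝ) / 2)) *
        ‖(∑' q : ι × (Fin n → ℤ), η j q * atom (ψ q.1) (j : ℤ) q.2 x) -
          ∑' q : ι × (Fin n → ℤ), η j q * atom (ψ q.1) (j : ℤ) q.2 y‖ₑ ≤
      a22 ψ s * edist x y ^ s := by
  have hterm : ∀ j : ℕ, (2 : ℝ≥0∞) ^ (-(j : ℝ) * (s + (n : ℝ) / 2)) *
        ‖(∑' q : ι × (Fin n → ℤ), η j q * atom (ψ q.1) (j : ℤ) q.2 x) -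
          ∑' q : ι × (Fin n → ℤ), η j q * atom (ψ q.1) (j : ℤ) q.2 y‖ₑ =
      ENNReal.ofReal (((2 : ℝ) ^ (-s)) ^ j * ‖signedSum ψ (η j) (((2 : ℝ) ^ j) • x) -
        signedSum ψ (η j) (((2 : ℝ) ^ j) • y)‖) := fun j => by
    rw [tsum_mul_atom, tsum_mul_atom, ← smul_sub, ← ofReal_norm, norm_smul,
      two_rpow_ennreal_eq, ← ENNReal.ofReal_mul (by positivity), ← mul_assoc,
      Real.norm_of_nonneg (by positivity), ← Real.rpow_add (by norm_num), zpow_natCast,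
      ← Real.rpow_natCast ((2 : ℝ) ^ (-s)), ← Real.rpow_mul (by norm_num)]
    congr 3
    push_cast
    ring_nf
  simp_rw [hterm]
  rw [a22_eq_ofReal hψ hc hs0 hs1, edist_dist, ENNReal.ofReal_rpow_of_nonneg dist_nonneg hs0.le]
  have hSD : 0 ≤ ∑ i, (supSumDeriv ψ i).toReal := Finset.sum_nonneg fun _ _ => ENNReal.toReal_nonneg
  have hfin := supSum_lt_top hψ fun ε => (hc ε).continuous
  rw [← ENNReal.ofReal_mul' (by positivity)]
  refine tsum_ofReal_dyadic_le hs0 hs1 ENNReal.toReal_nonneg hSD dist_nonneg (fun j => ?_)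
    (fun j => ?_)
  · gcongr
    refine (norm_sub_le _ _).trans ?_
    linarith [norm_signedSum_le hfin (hη j) (((2 : ℝ) ^ j) • x),
      norm_signedSum_le hfin (hη j) (((2 : ℝ) ^ j) • y)]
  · have h1 := norm_signedSum_sub_le hψ hc (hη j) (((2 : ℝ) ^ j) • x) (((2 : ℝ) ^ j) • y)
    rw [← smul_sub, norm_smul, Real.norm_of_nonneg (by positivity), ← dist_eq_norm x y] at h1
    have h2 : ((2 : ℝ) ^ (1 - s)) ^ j = ((2 : ℝ) ^ (-s)) ^ j * 2 ^ j := by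
      rw [← mul_pow, sub_eq_add_neg, Real.rpow_add (by norm_num), Real.rpow_one, mul_comm]
    calc _ ≤ ((2 : ℝ) ^ (-s)) ^ j *
          ((∑ i, (supSumDeriv ψ i).toReal) * (2 ^ j * dist x y)) := by gcongr
      _ = _ := by rw [h2]; ring

theorem enorm_tsum_sub_le_a21 {φ : E n → 𝕜} {s : ℝ} (hs0 : 0 < s) {η : (Fin n → ℤ) → 𝕜}
    (hη : ∀ k, ‖η k‖ = 1) (x y : E n) :
    ‖(∑' k, η k * atom φ 0 k x) - ∑' k, η k * atom φ 0 k y‖ₑ ≤ a21 φ s * edist x y ^ s := by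
  by_cases hxy : x = y
  · simp [hxy]
  · have h0 : edist x y ^ s ≠ 0 := by
      rw [ne_eq, ENNReal.rpow_eq_zero_iff_of_pos hs0]
      exact (edist_pos.2 hxy).ne'
    have ht : edist x y ^ s ≠ ⊤ := ENNReal.rpow_ne_top_of_nonneg hs0.le (edist_ne_top _ _)
    rw [← ENNReal.div_le_iff h0 ht]
    exact ((le_iSup (fun _ : x ≠ y => ‖(∑' k, η k * atom φ 0 k x) -
      ∑' k, η k * atom φ 0 k y‖ₑ / edist x y ^ s) hxy).trans
      (le_iSup₂ (f := fun (x : E n) (y : E n) => ⨆ (_ : x ≠ y), ‖(∑' k, η k * atom φ 0 k x) -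
        ∑' k, η k * atom φ 0 k y‖ₑ / edist x y ^ s) x y)).trans
      (le_iSup₂ (f := fun (η : (Fin n → ℤ) → 𝕜) (_ : ∀ k, ‖η k‖ = 1) => ⨆ (x : E n) (y : E n)
        (_ : x ≠ y), ‖(∑' k, η k * atom φ 0 k x) -
        ∑' k, η k * atom φ 0 k y‖ₑ / edist x y ^ s) η hη)

theorem continuous_tsum_mul_atom [Finite ι] {ψ : ι → E n → 𝕜}
    (hψ : ∀ ε, HasCompactSupport (ψ ε)) (hc : ∀ ε, ContDiff ℝ 1 (ψ ε))
    (η : ι × (Fin n → ℤ) → 𝕜) (j : ℤ) :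
    Continuous fun x => ∑' q : ι × (Fin n → ℤ), η q * atom (ψ q.1) j q.2 x := by
  have hG : Continuous (signedSum ψ η) := by
    choose L hL _ using exists_hasFDerivAt_signedSum hψ hc η
    exact continuous_iff_continuousAt.2 fun x => (hL x).continuousAt
  simp_rw [tsum_mul_atom]
  fun_prop

/-- The wavelet distance is at most `upperConst` times the cost of any transport plan. The signs are
chosen separately on each level, and the levels are summed under the integral. -/
theorem waveletDist_le_lintegral [Finite ι] {φ : E n → 𝕜} {ψ : ι → E n → 𝕜}
    (hφ : HasCompactSupport φ) (hφc : ContDiff ℝ 1 φ)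
    (hψ : ∀ ε, HasCompactSupport (ψ ε)) (hψc : ∀ ε, ContDiff ℝ 1 (ψ ε)) {K : Set (E n)}
    (hK : Bornology.IsBounded K) {s : ℝ} (hs0 : 0 < s) (hs1 : s < 1) (C₀ C₁ : ℝ≥0)
    {μ ν : Measure (E n)} (hμ : IsProbAb2 K μ) (hν : IsProbAb2 K ν)
    {γ : Measure (E n × E n)} (hγ1 : γ.map Prod.fst = μ) (hγ2 : γ.map Prod.snd = ν) :
    waveletDist φ ψ C₀ C₁ s μ ν ≤
      upperConst φ ψ s C₀ C₁ * ∫⁻ z, edist z.1 z.2 ^ s ∂γ := by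
  have := hμ.isProbabilityMeasure
  have hm2 : Measurable fun z : E n × E n => edist z.1 z.2 ^ s := by fun_prop
  have hlow : ∑' k : Fin n → ℤ, ‖coeff μ ν φ 0 k‖ₑ ≤
      a21 φ s * ∫⁻ z, edist z.1 z.2 ^ s ∂γ := by
    obtain ⟨T, hT⟩ := exists_finset_atom_eq_zero (ι := Unit) (fun _ => hφ) hK 0
    classical
    obtain ⟨η, hη, hle⟩ := exists_signs_tsum_enorm_le hμ.concentrated hν.concentrated hγ1 hγ2
      (e := fun k => atom φ 0 k) (fun k => continuous_atom hφc.continuous 0 k)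
      (fun k => hasCompactSupport_atom hφ 0 k) (T.image Prod.snd)
      (fun k hk x hx => hT ((), k) (fun h => hk (Finset.mem_image.2 ⟨_, h, rfl⟩)) x hx)
    simp_rw [coeff_eq hμ hν hφ hφc.continuous]
    rw [← lintegral_const_mul _ hm2]
    exact hle.trans (lintegral_mono fun z => enorm_tsum_sub_le_a21 hs0 hη z.1 z.2)
  have hhigh : ∑' q : ι × ℕ × (Fin n → ℤ), (2 : ℝ≥0∞) ^ (-(q.2.1 : ℝ) * (s + (n : ℝ) / 2)) *
      ‖coeff μ ν (ψ q.1) (q.2.1 : ℤ) q.2.2‖ₑ ≤ a22 ψ s * ∫⁻ z, edist z.1 z.2 ^ s ∂γ := by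
    have hlevel : ∀ j : ℕ, ∃ η : ι × (Fin n → ℤ) → 𝕜, (∀ q, ‖η q‖ = 1) ∧
        ∑' q : ι × (Fin n → ℤ), ‖coeff μ ν (ψ q.1) (j : ℤ) q.2‖ₑ ≤
          ∫⁻ z, ‖(∑' q : ι × (Fin n → ℤ), η q * atom (ψ q.1) (j : ℤ) q.2 z.1) -
            ∑' q : ι × (Fin n → ℤ), η q * atom (ψ q.1) (j : ℤ) q.2 z.2‖ₑ ∂γ := fun j => by
      obtain ⟨T, hT⟩ := exists_finset_atom_eq_zero hψ hK (j : ℤ)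
      obtain ⟨η, hη, hle⟩ := exists_signs_tsum_enorm_le hμ.concentrated hν.concentrated hγ1 hγ2
        (e := fun q : ι × (Fin n → ℤ) => atom (ψ q.1) (j : ℤ) q.2)
        (fun q => continuous_atom (hψc q.1).continuous j q.2)
        (fun q => hasCompactSupport_atom (hψ q.1) j q.2) T hT
      refine ⟨η, hη, ?_⟩
      have e : ∀ q : ι × (Fin n → ℤ), coeff μ ν (ψ q.1) (j : ℤ) q.2 = _ := fun q =>
        coeff_eq hμ hν (hψ q.1) (hψc q.1).continuous j q.2
      simp_rw [e]
      exact hle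
    choose η hη hle using hlevel
    have e1 : ∑' q : ι × ℕ × (Fin n → ℤ), (2 : ℝ≥0∞) ^ (-(q.2.1 : ℝ) * (s + (n : ℝ) / 2)) *
        ‖coeff μ ν (ψ q.1) (q.2.1 : ℤ) q.2.2‖ₑ =
        ∑' j : ℕ, (2 : ℝ≥0∞) ^ (-(j : ℝ) * (s + (n : ℝ) / 2)) *
          ∑' q : ι × (Fin n → ℤ), ‖coeff μ ν (ψ q.1) (j : ℤ) q.2‖ₑ := by
      simp_rw [ENNReal.tsum_prod', ENNReal.tsum_mul_left]
      rw [ENNReal.tsum_comm]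
      simp_rw [ENNReal.tsum_mul_left]
    rw [e1, ← lintegral_const_mul _ hm2]
    calc _ ≤ ∑' j : ℕ, ∫⁻ z, (2 : ℝ≥0∞) ^ (-(j : ℝ) * (s + (n : ℝ) / 2)) *
          ‖(∑' q : ι × (Fin n → ℤ), η j q * atom (ψ q.1) (j : ℤ) q.2 z.1) -
            ∑' q : ι × (Fin n → ℤ), η j q * atom (ψ q.1) (j : ℤ) q.2 z.2‖ₑ ∂γ := by
          refine ENNReal.tsum_le_tsum fun j => ?_
          rw [lintegral_const_mul']
          · gcongr
            exact hle j
          · rw [two_rpow_ennreal_eq]; exact ENNReal.ofReal_ne_top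
      _ = ∫⁻ z, ∑' j : ℕ, (2 : ℝ≥0∞) ^ (-(j : ℝ) * (s + (n : ℝ) / 2)) *
          ‖(∑' q : ι × (Fin n → ℤ), η j q * atom (ψ q.1) (j : ℤ) q.2 z.1) -
            ∑' q : ι × (Fin n → ℤ), η j q * atom (ψ q.1) (j : ℤ) q.2 z.2‖ₑ ∂γ := by
          refine (lintegral_tsum fun j => ?_).symm
          have hcont := continuous_tsum_mul_atom hψ hψc (η j) (j : ℤ)
          have hcc := ((hcont.comp continuous_fst).sub (hcont.comp continuous_snd)).enorm
          exact (hcc.measurable.const_mul _).aemeasurable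
      _ ≤ _ := lintegral_mono fun z => tsum_enorm_levels_le hψ hψc hs0 hs1 η hη z.1 z.2
  rw [waveletDist, upperConst, add_mul, ENNReal.tsum_mul_left]
  simp_rw [mul_assoc (C₁ : ℝ≥0∞)]
  rw [ENNReal.tsum_mul_left]
  refine add_le_add ?_ ?_
  · calc _ ≤ (C₀ : ℝ≥0∞) * (a21 φ s * ∫⁻ z, edist z.1 z.2 ^ s ∂γ) := by gcongr
      _ = _ := by ring
  · calc _ ≤ (C₁ : ℝ≥0∞) * (a22 ψ s * ∫⁻ z, edist z.1 z.2 ^ s ∂γ) := by gcongr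
      _ = _ := by ring

end

/-! ### Expansion of the duality pairing in wavelet coefficients -/

section
variable {𝕜 : Type*} [RCLike 𝕜] {n : ℕ} {ι : Type*}

/-- By a change of variables, the integral against an atom of level `j` is a power of `2` times the
integral of `g` against a rescaling of `f` that is again `s`-Hölder with constant `1`. -/
theorem enorm_integral_mul_atom_le_holderDualNorm (g : E n → 𝕜) {s : ℝ}
    {f : E n → ℝ} (hf : ∀ x y, |f x - f y| ≤ ‖x - y‖ ^ s) (j : ℕ) (k : Fin n → ℤ) :
    ‖∫ x, (f x : 𝕜) * atom g (j : ℤ) k x‖ₑ ≤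
      (2 : ℝ≥0∞) ^ (-(j : ℝ) * (s + (n : ℝ) / 2)) * holderDualNorm s g := by
  set a : ℝ := (2 : ℝ) ^ (j : ℤ) with ha
  have ha0 : 0 < a := by positivity
  let F : E n → 𝕜 := fun y => ((a ^ s * f (a⁻¹ • (y + latticePt k)) : ℝ) : 𝕜)
  have hF : ∀ x y, ‖F x - F y‖ ≤ ‖x - y‖ ^ s := fun x y => by
    simp only [F]
    rw [← RCLike.ofReal_sub, RCLike.norm_ofReal, ← mul_sub, abs_mul,
      abs_of_pos (Real.rpow_pos_of_pos ha0 s)]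
    have h1 := hf (a⁻¹ • (x + latticePt k)) (a⁻¹ • (y + latticePt k))
    rw [← smul_sub, add_sub_add_right_eq_sub, norm_smul, Real.norm_of_nonneg (by positivity),
      Real.mul_rpow (by positivity) (norm_nonneg _), Real.inv_rpow ha0.le] at h1
    calc _ ≤ a ^ s * ((a ^ s)⁻¹ * ‖x - y‖ ^ s) := by gcongr
      _ = _ := mul_inv_cancel_left₀ (Real.rpow_pos_of_pos ha0 s).ne' _
  have hle : ‖∫ x, F x * g x‖ₑ ≤ holderDualNorm s g :=
    le_iSup₂ (f := fun (f : E n → 𝕜) (_ : ∀ x y, ‖f x - f y‖ ≤ ‖x - y‖ ^ s) =>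
      ‖∫ x, f x * g x‖ₑ) F hF
  have e : ∀ x, (f x : 𝕜) * atom g (j : ℤ) k x =
      ((2 : ℝ) ^ ((n : ℝ) * ((j : ℤ) : ℝ) / 2) * (a ^ s)⁻¹) •
        (F (a • x - latticePt k) * g (a • x - latticePt k)) := fun x => by
    simp only [atom, F, RCLike.real_smul_eq_coe_mul]
    rw [sub_add_cancel, smul_smul, inv_mul_cancel₀ ha0.ne', one_smul]
    have : ((a ^ s : ℝ) : 𝕜) ≠ 0 := by exact_mod_cast (Real.rpow_pos_of_pos ha0 s).ne'
    push_cast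
    field_simp
    rfl
  simp_rw [e]
  rw [integral_smul,
    Measure.integral_comp_smul volume (fun x => F (x - latticePt k) * g (x - latticePt k)) a,
    integral_sub_right_eq_self (fun x => F x * g x), smul_smul, enorm_smul, two_rpow_ennreal_eq]
  refine mul_le_mul' ?_ hle
  rw [Real.enorm_of_nonneg (by positivity)]
  refine ENNReal.ofReal_le_ofReal (le_of_eq ?_)
  rw [abs_of_nonneg (by positivity), finrank_euclideanSpace_fin,
    ha, zpow_natCast, ← Real.rpow_natCast (2 : ℝ) j, ← Real.rpow_natCast (_ : ℝ) n,
    ← Real.rpow_mul (by norm_num), ← Real.rpow_mul (by norm_num), ← Real.rpow_neg (by norm_num),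
    ← Real.rpow_neg (by norm_num), ← Real.rpow_add (by norm_num), ← Real.rpow_add (by norm_num)]
  congr 1
  push_cast
  ring

theorem enorm_integral_mul_atom_le_eLpNorm (φ : E n → 𝕜) {B : ℝ} {f : E n → ℝ}
    (hf : ∀ x, |f x| ≤ B) (k : Fin n → ℤ) :
    ‖∫ x, (f x : 𝕜) * atom φ 0 k x‖ₑ ≤ ENNReal.ofReal B * eLpNorm φ 1 volume := by
  refine (enorm_integral_le_lintegral_enorm _).trans ?_
  rw [eLpNorm_one_eq_lintegral_enorm,
    ← lintegral_sub_right_eq_self (fun x => ‖φ x‖ₑ) (latticePt k),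
    ← lintegral_const_mul' _ _ ENNReal.ofReal_ne_top]
  refine lintegral_mono fun x => ?_
  rw [enorm_mul, atom_zero]
  gcongr
  rw [← ofReal_norm, RCLike.norm_ofReal]
  exact ENNReal.ofReal_le_ofReal (hf x)

/-- An atom of nonnegative level that meets a ball of radius `M` is supported in a ball of radius
`M + 2 R`, which does not depend on the level. -/
theorem atom_eq_zero_on_or_off_ball {f : E n → 𝕜} {R M : ℝ}
    (hR : ∀ x, R < ‖x‖ → f x = 0) (j : ℕ) (k : Fin n → ℤ) {K : Set (E n)}
    (hM : ∀ x ∈ K, ‖x‖ ≤ M) :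
    (∀ x ∈ K, atom f (j : ℤ) k x = 0) ∨ ∀ y, M + 2 * R < ‖y‖ → atom f (j : ℤ) k y = 0 := by
  by_contra! h
  obtain ⟨⟨x, hxK, hx⟩, y, hy, hy0⟩ := h
  have key : ∀ z, atom f (j : ℤ) k z ≠ 0 → ‖((2 : ℝ) ^ (j : ℤ)) • z - latticePt k‖ ≤ R := by
    intro z hz
    by_contra! hlt
    exact hz (by rw [atom, hR _ hlt, smul_zero])
  have h1 : ‖((2 : ℝ) ^ (j : ℤ)) • (y - x)‖ ≤ 2 * R := by
    have e : ((2 : ℝ) ^ (j : ℤ)) • (y - x) = (((2 : ℝ) ^ (j : ℤ)) • y - latticePt k) -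
      (((2 : ℝ) ^ (j : ℤ)) • x - latticePt k) := by rw [smul_sub]; abel
    rw [e]
    refine (norm_sub_le _ _).trans ?_
    linarith [key x hx, key y hy0]
  rw [norm_smul, Real.norm_of_nonneg (by positivity), zpow_natCast] at h1
  have h2 : ‖y - x‖ ≤ 2 ^ j * ‖y - x‖ :=
    le_mul_of_one_le_left (norm_nonneg _) (one_le_pow₀ (by norm_num))
  have h3 : ‖y‖ ≤ ‖y - x‖ + ‖x‖ := by simpa using norm_add_le (y - x) x
  linarith [hM x hxK]

theorem coeff_eq_zero {K : Set (E n)} {μ ν : Measure (E n)} (hμ : IsProbAb2 K μ)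
    (hν : IsProbAb2 K ν) {f : E n → 𝕜} (hf : HasCompactSupport f) (hc : Continuous f)
    {j : ℤ} {k : Fin n → ℤ} (h : ∀ x ∈ K, atom f j k x = 0) : coeff μ ν f j k = 0 := by
  rw [coeff_eq hμ hν hf hc,
    integral_eq_zero_of_eqOn_zero hμ.concentrated fun x hx => by rw [h x hx, map_zero],
    integral_eq_zero_of_eqOn_zero hν.concentrated fun x hx => by rw [h x hx, map_zero], sub_zero]

/-- The duality pairing of a bounded Hölder function with `μ - ν`, bounded by the wavelet
coefficients of `p_μ - p_ν`. -/
theorem enorm_integral_sub_le [Finite ι] {V : ℤ → Submodule 𝕜 (L2 𝕜 n)} {φ : E n → 𝕜}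
    {ψ : ι → E n → 𝕜} (hsys : IsWaveletSystem V φ ψ)
    (hφ : HasCompactSupport φ) (hφc : Continuous φ)
    (hψ : ∀ ε, HasCompactSupport (ψ ε)) (hψc : ∀ ε, Continuous (ψ ε)) {K : Set (E n)}
    (hK : Bornology.IsBounded K) {s : ℝ} (hs0 : 0 < s)
    {μ ν : Measure (E n)} (hμ : IsProbAb2 K μ) (hν : IsProbAb2 K ν) {f : E n → ℝ} {B : ℝ}
    (hf : ∀ x y, |f x - f y| ≤ ‖x - y‖ ^ s) (hfB : ∀ x, |f x| ≤ B) :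
    ENNReal.ofReal (∫ x, f x ∂μ - ∫ x, f x ∂ν) ≤
      (∑' k : Fin n → ℤ, ENNReal.ofReal B * eLpNorm φ 1 volume * ‖coeff μ ν φ 0 k‖ₑ) +
        ∑' q : ι × ℕ × (Fin n → ℤ), (2 : ℝ≥0∞) ^ (-(q.2.1 : ℝ) * (s + (n : ℝ) / 2)) *
          holderDualNorm s (ψ q.1) * ‖coeff μ ν (ψ q.1) (q.2.1 : ℤ) q.2.2‖ₑ := by
  have := hμ.isProbabilityMeasure
  have := hν.isProbabilityMeasure
  have hfc : Continuous f :=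
    continuous_of_abs_sub_le_dist_rpow hs0 fun x y => by
      rw [Real.norm_eq_abs, dist_eq_norm]; exact hf x y
  obtain ⟨M, hM⟩ := hK.exists_norm_le
  obtain ⟨R, hR0, hR⟩ := exists_radius_of_hasCompactSupport hψ
  obtain ⟨R', hR0', hR'⟩ := exists_radius_of_hasCompactSupport (ι := Unit) fun _ => hφ
  set A : Set (E n) := Metric.closedBall 0 (M + 2 * max R R') with hA
  have hAm : MeasurableSet A := Metric.isClosed_closedBall.measurableSet
  have hKA : K ⊆ A := fun x hx => by
    rw [hA, mem_closedBall_zero_iff]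
    linarith [hM x hx, hR0.trans (le_max_left R R')]
  -- `f` itself need not be square-integrable; its truncation to `A` has the same integral against
  -- `p_μ - p_ν`, and against every atom with a nonzero coefficient.
  let F : E n → 𝕜 := A.indicator fun x => (f x : 𝕜)
  have hfc' : Continuous fun x => (f x : 𝕜) := RCLike.continuous_ofReal.comp hfc
  have hF2 : MemLp F 2 volume := by
    rw [memLp_indicator_iff_restrict hAm]
    have : IsFiniteMeasure (volume.restrict A) :=
      ⟨by rw [Measure.restrict_apply_univ]; exact measure_closedBall_lt_top⟩
    exact MemLp.of_bound hfc'.aestronglyMeasurable B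
      (Filter.Eventually.of_forall fun x => by rw [RCLike.norm_ofReal]; exact hfB x)
  have hG2 : MemLp (fun x => ((density μ x - density ν x : ℝ) : 𝕜)) 2 volume :=
    (hμ.memLp_density.sub hν.memLp_density).ofReal
  have hint : ∀ ρ : Measure (E n), IsFiniteMeasure ρ → Integrable F ρ := fun ρ _ =>
    (Integrable.of_bound hfc'.aestronglyMeasurable B
      (Filter.Eventually.of_forall fun x => by rw [RCLike.norm_ofReal]; exact hfB x)).indicator hAm
  have hFint : ∀ ρ : Measure (E n), ρ Kᶜ = 0 → ∫ x, F x ∂ρ = ((∫ x, f x ∂ρ : ℝ) : 𝕜) :=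
    fun ρ hρ => by
      rw [← integral_ofReal]
      refine integral_congr_ae ?_
      have hae : ∀ᵐ x ∂ρ, x ∈ K := by rwa [ae_iff]
      filter_upwards [hae] with x hx using Set.indicator_of_mem (hKA hx) _
  have hconjF : ∀ x, (starRingEnd 𝕜) (F x) = F x := fun x => by
    by_cases hx : x ∈ A
    · simp [F, hx]
    · simp [F, hx]
  obtain ⟨b, hbφ, hbψ⟩ := exists_hilbertBasis_wavelet hsys
  have hFG : inner 𝕜 (hF2.toLp F) (hG2.toLp _) =
      ((∫ x, f x ∂μ - ∫ x, f x ∂ν : ℝ) : 𝕜) := by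
    rw [L2.inner_def, RCLike.ofReal_sub, ← hFint μ hμ.concentrated, ← hFint ν hν.concentrated,
      ← integral_density_sub_mul hμ hν (hint μ inferInstance) (hint ν inferInstance)]
    refine integral_congr_ae ?_
    filter_upwards [hF2.coeFn_toLp, hG2.coeFn_toLp] with x h1 h2
    rw [h1, h2, RCLike.inner_apply, hconjF]
  have hbG : ∀ (i) (g : E n → 𝕜) (j : ℤ) (k), (b i : E n → 𝕜) =ᵐ[volume] atom g j k →
      inner 𝕜 (b i) (hG2.toLp _) = coeff μ ν g j k := fun i g j k hi => by
    rw [L2.inner_def, coeff]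
    refine integral_congr_ae ?_
    filter_upwards [hi, hG2.coeFn_toLp] with x h1 h2
    rw [h1, h2, RCLike.inner_apply]
  have hFb : ∀ (i) (g : E n → 𝕜) (j : ℤ) (k), (b i : E n → 𝕜) =ᵐ[volume] atom g j k →
      (∀ y, M + 2 * max R R' < ‖y‖ → atom g j k y = 0) →
      inner 𝕜 (hF2.toLp F) (b i) = ∫ x, (f x : 𝕜) * atom g j k x := fun i g j k hi hz => by
    rw [L2.inner_def]
    refine integral_congr_ae ?_
    filter_upwards [hi, hF2.coeFn_toLp] with x h1 h2
    rw [h1, h2, RCLike.inner_apply, hconjF, mul_comm]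
    by_cases hx : x ∈ A
    · rw [show F x = (f x : 𝕜) from Set.indicator_of_mem hx _]
    · rw [hz x (by simpa [hA] using hx), mul_zero, mul_zero]
  have hsum := (b.hasSum_inner_mul_inner (hF2.toLp F) (hG2.toLp _)).tsum_eq
  have hI : ENNReal.ofReal (∫ x, f x ∂μ - ∫ x, f x ∂ν) ≤
      ‖(inner 𝕜 (hF2.toLp F) (hG2.toLp _) : 𝕜)‖ₑ := by
    rw [hFG, ← ofReal_norm, RCLike.norm_ofReal]
    exact ENNReal.ofReal_le_ofReal (le_abs_self _)
  refine hI.trans ?_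
  rw [← hsum]
  refine enorm_tsum_le_tsum_enorm.trans ?_
  rw [Summable.tsum_sum ENNReal.summable ENNReal.summable]
  refine add_le_add (ENNReal.tsum_le_tsum fun k => ?_) (ENNReal.tsum_le_tsum fun q => ?_)
  · rw [enorm_mul, hbG _ _ _ _ (hbφ k)]
    rcases atom_eq_zero_on_or_off_ball (f := φ) (R := max R R') (fun x hx =>
      image_eq_zero_of_notMem_tsupport (hR' () x ((le_max_right _ _).trans_lt hx))) 0 k hM
      with h | h
    · rw [coeff_eq_zero hμ hν hφ hφc (by exact_mod_cast h)]; simp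
    · rw [hFb _ _ _ _ (hbφ k) (by exact_mod_cast h)]
      gcongr
      exact enorm_integral_mul_atom_le_eLpNorm φ hfB k
  · rw [enorm_mul, hbG _ _ _ _ (hbψ q)]
    rcases atom_eq_zero_on_or_off_ball (f := ψ q.1) (R := max R R') (fun x hx =>
      image_eq_zero_of_notMem_tsupport (hR q.1 x ((le_max_left _ _).trans_lt hx))) q.2.1 q.2.2 hM
      with h | h
    · rw [coeff_eq_zero hμ hν (hψ q.1) (hψc q.1) h]; simp
    · rw [hFb _ _ _ _ (hbψ q) h]
      gcongr
      exact enorm_integral_mul_atom_le_holderDualNorm (ψ q.1) hf q.2.1 q.2.2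

end

/-! ### The constants, and the lower bound -/

section
variable {𝕜 : Type*} [RCLike 𝕜] {n : ℕ} {ι : Type*} {V : ℤ → Submodule 𝕜 (L2 𝕜 n)}
  {φ : E n → 𝕜} {ψ : ι → E n → 𝕜}

theorem exists_wavelet_ne_zero (hsys : IsWaveletSystem V φ ψ) (ε : ι) : ∃ x, ψ ε x ≠ 0 := by
  by_contra! h
  obtain ⟨b, hb⟩ := hsys.basis 0
  have h1 : ((b (ε, 0) : detailSpace V 0) : L2 𝕜 n) = 0 := by
    refine Lp.ext ?_
    filter_upwards [hb ε 0, Lp.coeFn_zero 𝕜 2 (volume : Measure (E n))] with x hx hx0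
    rw [hx, hx0, atom, h, smul_zero, Pi.zero_apply]
  have h2 : ‖((b (ε, 0) : detailSpace V 0) : L2 𝕜 n)‖ = 1 := b.orthonormal.norm_eq_one _
  rw [h1, norm_zero] at h2
  exact zero_ne_one h2

theorem eLpNorm_scaling_ne_zero (hM : IsMultiresolution V φ) (hc : Continuous φ) :
    eLpNorm φ 1 volume ≠ 0 := by
  intro h
  rw [eLpNorm_eq_zero_iff hc.aestronglyMeasurable one_ne_zero] at h
  have h1 : ∫ x, φ x = 0 := by
    rw [integral_congr_ae h]
    simp
  rw [hM.integral_scaling] at h1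
  exact one_ne_zero h1

variable [Finite ι]

theorem iSup_holderDualNorm_ne_top (hsys : IsWaveletSystem V φ ψ)
    (hψ : ∀ ε, HasCompactSupport (ψ ε)) (hc : ∀ ε, Continuous (ψ ε)) {s : ℝ} (hs0 : 0 < s) :
    ⨆ ε, holderDualNorm s (ψ ε) ≠ ⊤ := by
  cases nonempty_fintype ι
  refine ne_top_of_le_ne_top (b := ∑ ε, holderDualNorm s (ψ ε)) ?_ (iSup_le fun ε => ?_)
  · exact ENNReal.sum_ne_top.2 fun ε _ =>
      (holderDualNorm_lt_top (hψ ε) (hc ε) (hsys.integral_wavelet ε) hs0).ne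
  · exact Finset.single_le_sum (f := fun ε => holderDualNorm s (ψ ε)) (fun _ _ => zero_le)
      (Finset.mem_univ ε)

omit [Finite ι] in
theorem iSup_holderDualNorm_ne_zero (hsys : IsWaveletSystem V φ ψ)
    (hψ : ∀ ε, HasCompactSupport (ψ ε)) (hc : ∀ ε, ContDiff ℝ 1 (ψ ε)) {s : ℝ} (hs0 : 0 < s)
    (hs1 : s ≤ 1) : ⨆ ε, holderDualNorm s (ψ ε) ≠ 0 := by
  obtain ⟨ε⟩ := nonempty_of_isWaveletSystem hsys
  obtain ⟨x, hx⟩ := exists_wavelet_ne_zero hsys ε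
  exact ((holderDualNorm_pos (hψ ε) (hc ε) hx hs0 hs1).trans_le
    (le_iSup (fun ε => holderDualNorm s (ψ ε)) ε)).ne'

theorem lowerConst_pos (hsys : IsWaveletSystem V φ ψ) (hφ : HasCompactSupport φ)
    (hφc : Continuous φ) (hψ : ∀ ε, HasCompactSupport (ψ ε)) (hψc : ∀ ε, Continuous (ψ ε))
    {s : ℝ} (hs0 : 0 < s) {C₀ C₁ : ℝ≥0} (hC₀ : 0 < C₀) (hC₁ : 0 < C₁) (B : ℝ) :
    0 < lowerConst φ ψ s C₀ C₁ B := by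
  have h1 : eLpNorm φ 1 volume ≠ ⊤ :=
    ((hφc.memLp_of_hasCompactSupport hφ).eLpNorm_lt_top).ne
  refine lt_min (ENNReal.div_pos (mul_ne_zero ?_ ?_) ENNReal.ofReal_ne_top)
    (ENNReal.mul_pos ?_ ?_)
  · exact (ENNReal.div_pos one_ne_zero h1).ne'
  · exact_mod_cast hC₀.ne'
  · exact (ENNReal.div_pos one_ne_zero (iSup_holderDualNorm_ne_top hsys hψ hψc hs0)).ne'
  · exact_mod_cast hC₁.ne'

omit [Finite ι] in
theorem lowerConst_lt_top (hsys : IsWaveletSystem V φ ψ) (hψ : ∀ ε, HasCompactSupport (ψ ε))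
    (hψc : ∀ ε, ContDiff ℝ 1 (ψ ε)) {s : ℝ} (hs0 : 0 < s) (hs1 : s ≤ 1) (C₀ C₁ : ℝ≥0) (B : ℝ) :
    lowerConst φ ψ s C₀ C₁ B < ⊤ := by
  refine (min_le_right _ _).trans_lt (ENNReal.mul_lt_top ?_ ENNReal.coe_lt_top)
  exact ENNReal.div_lt_top ENNReal.one_ne_top (iSup_holderDualNorm_ne_zero hsys hψ hψc hs0 hs1)

theorem upperConst_pos (hsys : IsWaveletSystem V φ ψ) (hψ : ∀ ε, HasCompactSupport (ψ ε))
    {s : ℝ} (hs0 : 0 < s) (C₀ : ℝ≥0) {C₁ : ℝ≥0} (hC₁ : 0 < C₁) :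
    0 < upperConst φ ψ s C₀ C₁ := by
  obtain ⟨ε⟩ := nonempty_of_isWaveletSystem hsys
  obtain ⟨x, hx⟩ := exists_wavelet_ne_zero hsys ε
  have h2 : (2 : ℝ) ^ (-s) < 1 := Real.rpow_lt_one_of_one_lt_of_neg (by norm_num) (by linarith)
  have h3 : 0 < 2 / (1 - (2 : ℝ) ^ (-s)) := div_pos (by norm_num) (by linarith)
  have h4 : 0 < a22 ψ s :=
    (ENNReal.mul_pos (ENNReal.ofReal_pos.2 h3).ne' (supSum_pos hψ hx).ne').trans_le le_add_self
  exact (ENNReal.mul_pos h4.ne' (by exact_mod_cast hC₁.ne')).trans_le le_add_self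

theorem upperConst_lt_top (hφ : HasCompactSupport φ) (hφc : ContDiff ℝ 1 φ)
    (hψ : ∀ ε, HasCompactSupport (ψ ε)) (hψc : ∀ ε, ContDiff ℝ 1 (ψ ε)) {s : ℝ} (hs0 : 0 < s)
    (hs1 : s < 1) (C₀ C₁ : ℝ≥0) : upperConst φ ψ s C₀ C₁ < ⊤ := by
  refine ENNReal.add_lt_top.2 ⟨ENNReal.mul_lt_top (a21_lt_top hφ hφc hs0 hs1.le)
    ENNReal.coe_lt_top, ENNReal.mul_lt_top ?_ ENNReal.coe_lt_top⟩
  rw [a22_eq_ofReal hψ hψc hs0 hs1]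
  exact ENNReal.ofReal_lt_top

/-- The bound of the duality pairing by the wavelet distance. For `B = 0` the first entry of the
minimum in `lowerConst` is `⊤`, but there it multiplies `B ^ s = 0`. -/
theorem lowerConst_mul_ofReal_le (hsys : IsWaveletSystem V φ ψ) (hφ : HasCompactSupport φ)
    (hφc : Continuous φ) (hψ : ∀ ε, HasCompactSupport (ψ ε)) (hψc : ∀ ε, ContDiff ℝ 1 (ψ ε))
    {K : Set (E n)} (hK : Bornology.IsBounded K) {s : ℝ} (hs0 : 0 < s) (hs1 : s ≤ 1)
    (C₀ C₁ : ℝ≥0) {μ ν : Measure (E n)} (hμ : IsProbAb2 K μ) (hν : IsProbAb2 K ν)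
    {f : E n → ℝ} {B : ℝ} (hf : ∀ x y, |f x - f y| ≤ ‖x - y‖ ^ s) (hfB : ∀ x, |f x| ≤ B ^ s) :
    lowerConst φ ψ s C₀ C₁ B * ENNReal.ofReal (∫ x, f x ∂μ - ∫ x, f x ∂ν) ≤
      waveletDist φ ψ C₀ C₁ s μ ν := by
  set D := lowerConst φ ψ s C₀ C₁ B with hD
  have hφ0 := eLpNorm_scaling_ne_zero hsys.multiresolution hφc
  have hφt : eLpNorm φ 1 volume ≠ ⊤ :=
    ((hφc.memLp_of_hasCompactSupport hφ).eLpNorm_lt_top).ne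
  have hψ0 := iSup_holderDualNorm_ne_zero hsys hψ hψc hs0 hs1
  have hψt := iSup_holderDualNorm_ne_top hsys hψ (fun ε => (hψc ε).continuous) hs0
  have hD0 : D * (ENNReal.ofReal (B ^ s) * eLpNorm φ 1 volume) ≤ C₀ := by
    calc _ ≤ (1 / eLpNorm φ 1 volume * C₀ / ENNReal.ofReal (B ^ s)) *
          (ENNReal.ofReal (B ^ s) * eLpNorm φ 1 volume) := by
          gcongr
          exact min_le_left _ _
      _ = (1 / eLpNorm φ 1 volume * C₀ / ENNReal.ofReal (B ^ s)) * ENNReal.ofReal (B ^ s) *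
          eLpNorm φ 1 volume := (mul_assoc _ _ _).symm
      _ ≤ (1 / eLpNorm φ 1 volume * C₀) * eLpNorm φ 1 volume := by
          exact mul_le_mul' (ENNReal.mul_le_of_le_div le_rfl) le_rfl
      _ = C₀ := by
          rw [one_div, mul_right_comm, ENNReal.inv_mul_cancel hφ0 hφt, one_mul]
  have hD1 : ∀ ε, D * holderDualNorm s (ψ ε) ≤ C₁ := fun ε => by
    calc _ ≤ (1 / ⨆ ε, holderDualNorm s (ψ ε)) * C₁ * ⨆ ε, holderDualNorm s (ψ ε) := by
          gcongr
          · exact min_le_right _ _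
          · exact le_iSup (fun ε => holderDualNorm s (ψ ε)) ε
      _ = C₁ := by
          rw [one_div, mul_right_comm, ENNReal.inv_mul_cancel hψ0 hψt, one_mul]
  calc _ ≤ D * ((∑' k : Fin n → ℤ,
          ENNReal.ofReal (B ^ s) * eLpNorm φ 1 volume * ‖coeff μ ν φ 0 k‖ₑ) +
        ∑' q : ι × ℕ × (Fin n → ℤ), (2 : ℝ≥0∞) ^ (-(q.2.1 : ℝ) * (s + (n : ℝ) / 2)) *
          holderDualNorm s (ψ q.1) * ‖coeff μ ν (ψ q.1) (q.2.1 : ℤ) q.2.2‖ₑ) := by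
        gcongr
        exact enorm_integral_sub_le hsys hφ hφc hψ (fun ε => (hψc ε).continuous) hK hs0 hμ hν hf hfB
    _ ≤ waveletDist φ ψ C₀ C₁ s μ ν := by
        rw [mul_add, ← ENNReal.tsum_mul_left, ← ENNReal.tsum_mul_left]
        refine add_le_add (ENNReal.tsum_le_tsum fun k => ?_) (ENNReal.tsum_le_tsum fun q => ?_)
        · rw [← mul_assoc]
          gcongr
        · calc _ = (D * holderDualNorm s (ψ q.1)) *
                ((2 : ℝ≥0∞) ^ (-(q.2.1 : ℝ) * (s + (n : ℝ) / 2)) *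
                  ‖coeff μ ν (ψ q.1) (q.2.1 : ℤ) q.2.2‖ₑ) := by ring
            _ ≤ C₁ * ((2 : ℝ≥0∞) ^ (-(q.2.1 : ℝ) * (s + (n : ℝ) / 2)) *
                  ‖coeff μ ν (ψ q.1) (q.2.1 : ℤ) q.2.2‖ₑ) := mul_le_mul' (hD1 q.1) le_rfl
            _ = _ := (mul_assoc _ _ _).symm

end

end WaveletWasserstein

open WaveletWasserstein

theorem theorem3p11 {𝕜 : Type*} [RCLike 𝕜] {n : ℕ} {ι : Type*} [Finite ι]
    (V : ℤ → Submodule 𝕜 (WaveletWasserstein.L2 𝕜 n))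
    (φ : WaveletWasserstein.E n → 𝕜) (ψ : ι → WaveletWasserstein.E n → 𝕜)
    (hsys : WaveletWasserstein.IsWaveletSystem V φ ψ)
    (r : ℕ) (hr : 1 ≤ r)
    (hφreg : WaveletWasserstein.IsRegular r φ)
    (hψreg : ∀ ε, WaveletWasserstein.IsRegular r (ψ ε))
    (hφsupp : HasCompactSupport φ) (hψsupp : ∀ ε, HasCompactSupport (ψ ε))
    (K : Set (WaveletWasserstein.E n)) (hK : IsCompact K)
    (s : ℝ) (hs0 : 0 < s) (hs1 : s < 1)
    (C₀ C₁ : ℝ≥0) (hC₀ : 0 < C₀) (hC₁ : 0 < C₁) :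
    (0 < WaveletWasserstein.lowerConst φ ψ s C₀ C₁ (Metric.diam K) ∧
      WaveletWasserstein.lowerConst φ ψ s C₀ C₁ (Metric.diam K) < ⊤) ∧
    (0 < WaveletWasserstein.upperConst φ ψ s C₀ C₁ ∧
      WaveletWasserstein.upperConst φ ψ s C₀ C₁ < ⊤) ∧
    ∀ μ ν : Measure (WaveletWasserstein.E n),
      WaveletWasserstein.IsProbAb2 K μ → WaveletWasserstein.IsProbAb2 K ν →
      WaveletWasserstein.lowerConst φ ψ s C₀ C₁ (Metric.diam K) *
          WaveletWasserstein.wasserstein s μ ν ≤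
        WaveletWasserstein.waveletDist φ ψ C₀ C₁ s μ ν ∧
      WaveletWasserstein.waveletDist φ ψ C₀ C₁ s μ ν ≤
        WaveletWasserstein.upperConst φ ψ s C₀ C₁ *
          WaveletWasserstein.wasserstein s μ ν := by
  have hφc : ContDiff ℝ 1 φ := hφreg.1.of_le (by exact_mod_cast hr)
  have hψc : ∀ ε, ContDiff ℝ 1 (ψ ε) := fun ε => (hψreg ε).1.of_le (by exact_mod_cast hr)
  have hDt := lowerConst_lt_top hsys hψsupp hψc hs0 hs1.le C₀ C₁ (Metric.diam K)
  refine ⟨⟨lowerConst_pos hsys hφsupp hφc.continuous hψsupp (fun ε => (hψc ε).continuous) hs0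
    hC₀ hC₁ _, hDt⟩, ⟨upperConst_pos hsys hψsupp hs0 C₀ hC₁,
    upperConst_lt_top hφsupp hφc hψsupp hψc hs0 hs1 C₀ C₁⟩, fun μ ν hμ hν => ⟨?_, ?_⟩⟩
  · have := hμ.isProbabilityMeasure
    have := hν.isProbabilityMeasure
    set D := lowerConst φ ψ s C₀ C₁ (Metric.diam K) with hD
    refine ENNReal.le_of_forall_pos_le_add fun δ hδ _ => ?_
    -- The error of the dual approximation is chosen so that `D` times it is at most `δ`.
    obtain ⟨f, hf, hfB, hW⟩ := exists_holder_wasserstein_le hK hs0 hs1.le μ ν hμ.concentrated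
      hν.concentrated (ε := δ / (D.toReal + 1)) (by positivity)
    calc D * wasserstein s μ ν
        ≤ D * (ENNReal.ofReal (∫ x, f x ∂μ - ∫ x, f x ∂ν) +
            ENNReal.ofReal (δ / (D.toReal + 1))) := by
          gcongr
          exact hW.trans ENNReal.ofReal_add_le
      _ ≤ waveletDist φ ψ C₀ C₁ s μ ν + δ := by
          rw [mul_add]
          refine add_le_add (lowerConst_mul_ofReal_le hsys hφsupp hφc.continuous hψsupp hψc
            hK.isBounded hs0 hs1.le C₀ C₁ hμ hν hf hfB) ?_
          rw [← ENNReal.ofReal_toReal hDt.ne, ← ENNReal.ofReal_mul ENNReal.toReal_nonneg,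
            ← ENNReal.ofReal_coe_nnreal, ENNReal.toReal_ofReal ENNReal.toReal_nonneg]
          refine ENNReal.ofReal_le_ofReal ?_
          have h0 : 0 ≤ D.toReal := ENNReal.toReal_nonneg
          rw [mul_div_assoc', div_le_iff₀ (by positivity)]
          nlinarith [δ.coe_nonneg]
  · rw [wasserstein, ENNReal.mul_iInf_of_ne
      (upperConst_pos hsys hψsupp hs0 C₀ hC₁).ne'
      (upperConst_lt_top hφsupp hφc hψsupp hψc hs0 hs1 C₀ C₁).ne]
    refine le_iInf fun γ => ?_
    rw [ENNReal.mul_iInf_of_ne (upperConst_pos hsys hψsupp hs0 C₀ hC₁).ne'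
      (upperConst_lt_top hφsupp hφc hψsupp hψc hs0 hs1 C₀ C₁).ne]
    exact le_iInf fun hγ => waveletDist_le_lintegral hφsupp hφc hψsupp hψc hK.isBounded hs0 hs1
      C₀ C₁ hμ hν hγ.1 hγ.2
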